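/- Let $d\ge 1$, write $|\cdot|$ for the Euclidean norm and $\mathcal L$ for Lebesgue measure on $\mathbb R^d$. Let $\Xi\subset\mathbb R^d$ be a locally finite set, whose elements are called centers, and let $\alpha\in[0,\infty]$. An allocation of $\mathbb R^d$ to $\Xi$ with appetite $\alpha$ is a measurable function $\psi:\mathbb R^d\to\Xi\cup\{\infty,\Delta\}$ such that $\mathcal L(\psi^{-1}(\Delta))=0$ and $\mathcal L(\psi^{-1}(\xi))\le\alpha$ for every $\xi\in\Xi$. A center $\xi$ is sated if $\mathcal L(\psi^{-1}(\xi))=\alpha$, and unsated otherwise; a site $x\in\mathbb R^d$ is claimed if $\psi(x)\in\Xi$, and unclaimed if $\psi(x)=\infty$. For a center $\xi$ and a site $x$ with $\psi(x)\notin\{\xi,\Delta\}$, say that $x$ desires $\xi$ if $x$ is unclaimed or $|x-\xi|<|x-\psi(x)|$, and that $\xi$ covets $x$ if $\xi$ is unsated or $|x-\xi|<|x'-\xi|$ for some $x'\in\psi^{-1}(\xi)$. The allocation is stable if there are no such $x$ and $\xi$ for which both $x$ desires $\xi$ and $\xi$ covets $x$. Let $\Pi$ be a simple point process on $\mathbb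 R^d$ which is ergodic under translations (its law is translation-invariant, and every translation-invariant event has probability $0$ or $1$), of intensity (mean number of points per unit volume) $\lambda\in(0,\infty)$. Let $[\Pi]=\{z\in\mathbb R^d:\Pi(\{z\})=1\}$ and $\alpha\in[0,\infty]$. Then: (i) if $\lambda\alpha<1$, then almost surely, for every stable allocation of $\mathbb R^d$ to $[\Pi]$ with appetite $\alpha$, all centers are sated and the set of unclaimed sites has infinite volume; (ii) if $\lambda\alpha=1$, then almost surely, for every stable allocation of $\mathbb R^d$ to $[\Pi]$ with appetite $\alpha$, all centers are sated and $\mathcal L$-almost every site is claimed; (iii) if $\lambda\alpha>1$, then almost surely, for every stable allocation of $\mathbb R^d$ to $[\Pi]$ with appetite $\alpha$, not all centers are sated and $\mathcal L$-almost every site is claimed. -/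

import Mathlib

open MeasureTheory
open scoped ENNReal NNReal

namespace StableAllocation

/-- `ℝ^d` with the Euclidean norm; its elements are called sites. -/
abbrev Site (d : ℕ) : Type := EuclideanSpace ℝ (Fin d)

/-- Possible values of an allocation: a center, `∞` (the site is unclaimed), or `Δ` (undefined). -/
inductive Target (d : ℕ) : Type where
  | center (ξ : Site d) : Target d
  | unclaimed : Target d
  | undefined : Target d

/-! ### Stable allocations to a set of centers -/

/-- The territory `ψ⁻¹(ξ)` of the center `ξ`. -/
def territory {d : ℕ} (ψ : Site d → Target d) (ξ : Site d) : Set (Site d) :=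
  {x | ψ x = Target.center ξ}

/-- The set `ψ⁻¹(∞)` of unclaimed sites. -/
def unclaimedSites {d : ℕ} (ψ : Site d → Target d) : Set (Site d) :=
  {x | ψ x = Target.unclaimed}

/-- The set `ψ⁻¹(Δ)` of sites at which the allocation is undefined. -/
def undefinedSites {d : ℕ} (ψ : Site d → Target d) : Set (Site d) :=
  {x | ψ x = Target.undefined}

/-- The site `x` is claimed, i.e. `ψ x` is a center. -/
def IsClaimed {d : ℕ} (ψ : Site d → Target d) (x : Site d) : Prop :=
  ∃ ξ, ψ x = Target.center ξ

/-- The function `ψ : ℝ^d → Ξ ∪ {∞, Δ}` is an allocation of `ℝ^d` to `Ξ` with appetite `α`.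
(Since `Ξ` is countable and discrete, measurability of `ψ` means that the preimages of the
individual values are measurable.) -/
structure IsAllocation {d : ℕ} (Ξ : Set (Site d)) (α : ℝ≥0∞) (ψ : Site d → Target d) :
    Prop where
  center_mem : ∀ x ξ, ψ x = Target.center ξ → ξ ∈ Ξ
  measurableSet_territory : ∀ ξ ∈ Ξ, MeasurableSet (territory ψ ξ)
  measurableSet_unclaimed : MeasurableSet (unclaimedSites ψ)
  measurableSet_undefined : MeasurableSet (undefinedSites ψ)
  volume_undefined : volume (undefinedSites ψ) = 0
  volume_territory_le : ∀ ξ ∈ Ξ, volume (territory ψ ξ) ≤ α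

/-- The center `ξ` is sated: its territory has volume equal to the appetite. -/
def IsSated {d : ℕ} (α : ℝ≥0∞) (ψ : Site d → Target d) (ξ : Site d) : Prop :=
  volume (territory ψ ξ) = α

/-- The site `x` desires the center `ξ`: it is unclaimed or strictly closer to `ξ` than to the
center to which it is allocated. -/
def Desires {d : ℕ} (ψ : Site d → Target d) (x ξ : Site d) : Prop :=
  (∃ ζ, ψ x = Target.center ζ ∧ dist x ξ < dist x ζ) ∨ ψ x = Target.unclaimed

/-- The center `ξ` covets the site `x`: `ξ` is unsated or strictly closer to `x` than to some site
of its territory. -/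
def Covets {d : ℕ} (α : ℝ≥0∞) (ψ : Site d → Target d) (ξ x : Site d) : Prop :=
  (∃ x' ∈ territory ψ ξ, dist x ξ < dist x' ξ) ∨ ¬ IsSated α ψ ξ

/-- The site-center pair `(x, ξ)` is unstable. -/
def IsUnstablePair {d : ℕ} (α : ℝ≥0∞) (ψ : Site d → Target d) (x ξ : Site d) : Prop :=
  ψ x ≠ Target.center ξ ∧ ψ x ≠ Target.undefined ∧ Desires ψ x ξ ∧ Covets α ψ ξ x

/-- `ψ` is a stable allocation of `ℝ^d` to `Ξ` with appetite `α`. -/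
def IsStableAllocation {d : ℕ} (Ξ : Set (Site d)) (α : ℝ≥0∞) (ψ : Site d → Target d) : Prop :=
  IsAllocation Ξ α ψ ∧ ∀ x, ∀ ξ ∈ Ξ, ¬ IsUnstablePair α ψ x ξ

/-! ### Point processes -/

/-- `μ` is a simple point measure: the counting measure of a locally finite set. -/
def IsSimplePointMeasure {d : ℕ} (μ : Measure (Site d)) : Prop :=
  ∃ S : Set (Site d), (∀ B, Bornology.IsBounded B → (S ∩ B).Finite) ∧
    μ = Measure.count.restrict S

/-- The support `[μ] = {z : μ {z} = 1}` of a simple point measure. -/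
def pointSupport {d : ℕ} (μ : Measure (Site d)) : Set (Site d) :=
  {z | μ {z} = 1}

/-- The translate of a measure by the vector `v`. -/
noncomputable def translateMeasure {d : ℕ} (v : Site d) (μ : Measure (Site d)) : Measure (Site d) :=
  μ.map (fun x => x + v)

/-- `N` is a simple point process on `ℝ^d`: a random measure that is a.s. a simple point
measure. -/
structure IsSimplePointProcess {Ω : Type*} [MeasurableSpace Ω] {d : ℕ} (P : Measure Ω)
    (N : Ω → Measure (Site d)) : Prop where
  measurable : Measurable N
  ae_simple : ∀ᵐ ω ∂P, IsSimplePointMeasure (N ω)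

/-- The law of `N` is invariant under all translations of `ℝ^d`. -/
def IsTranslationInvariant {Ω : Type*} [MeasurableSpace Ω] {d : ℕ} (P : Measure Ω)
    (N : Ω → Measure (Site d)) : Prop :=
  ∀ v : Site d, (P.map N).map (translateMeasure v) = P.map N

/-- `N` is ergodic under translations: its law is translation-invariant, and every
translation-invariant event has probability `0` or `1` under it. -/
def IsErgodic {Ω : Type*} [MeasurableSpace Ω] {d : ℕ} (P : Measure Ω)
    (N : Ω → Measure (Site d)) : Prop :=
  IsTranslationInvariant P N ∧
    ∀ A : Set (Measure (Site d)), MeasurableSet A → (∀ v : Site d, translateMeasure v ⁻¹' A = A) →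
      P.map N A = 0 ∨ P.map N A = 1

/-- The unit cube `[0,1)^d`. -/
def unitCube (d : ℕ) : Set (Site d) :=
  {x | ∀ i, 0 ≤ x i ∧ x i < 1}

/-- The intensity of a translation-invariant point process: the mean number of points in the unit
cube. -/
noncomputable def intensity {Ω : Type*} [MeasurableSpace Ω] {d : ℕ} (P : Measure Ω)
    (N : Ω → Measure (Site d)) : ℝ≥0∞ :=
  ∫⁻ ω, N ω (unitCube d) ∂P

end StableAllocation

/-! Up to null sets, a stable allocation is determined by one number per center: the radius up to
which the center covets sites. Almost every site goes to the nearest center whose radius reaches it,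
and stays unclaimed if no radius does. Stability becomes a fixed-point condition on the radii: every
load is at most `α`, with equality wherever the radius is finite (`isStableRadii_covetRadius`).

Larger radii mean more competition, which pushes the other centers' radii up, so the condition is
monotone. Iterating from `⊤` and from `⊥` yields a greatest and a least stable choice of radii. Both
are measurable, translation-equivariant functions of the point measure, and every stable allocation
lies between them (`le_greatestRadii`, `leastRadii_le`). Thus almost sure statements about two
explicit objects control all stable allocations simultaneously, even those depending on the
configuration in a non-measurable way.

For an equivariant field of stable radii, mass transport (`lintegral_volume_fieldReached`) equates
the expected reached volume of the unit cube with the expected total load of the centers in it. The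
former is at most 1; the latter is at most `λα`, and equals `λα` when all centers are sated. One
unsated center has infinite radius and so reaches every site; hence unreached volume and unsated
centers exclude each other. Together with ergodicity this decides the three phases.

Transfer to an arbitrary allocation uses that larger radii reach more sites, while satedness passes
from larger to smaller stable radii (`load_eq_of_le`). The greatest radii therefore give satedness
and unclaimed volume, the least radii give claimedness and unsated centers. -/

namespace StableAllocation

/-! ### Deterministic theory of radii for a fixed locally finite set. -/

section Deterministic

variable {d : ℕ} {S : Set (Site d)} {μ : Measure (Site d)} {R R' : Site d → ℝ≥0∞} {α : ℝ≥0∞}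

/-- `μ` is the counting measure of the locally finite set `S`. -/
structure CountsLocallyFinite (S : Set (Site d)) (μ : Measure (Site d)) : Prop where
  finite_inter : ∀ B, Bornology.IsBounded B → (S ∩ B).Finite
  eq_restrict : μ = Measure.count.restrict S

/-- The potential centers which have `x` within their radius and are strictly closer to `x` than
`z` is. -/
def rivals (R : Site d → ℝ≥0∞) (z x : Site d) : Set (Site d) :=
  {η | edist x η < R η ∧ edist x η < edist x z}

/-- The sites at distance less than `r` from `z` which are not taken by a rival of `z`. -/
def availableSites (μ : Measure (Site d)) (R : Site d → ℝ≥0∞) (z : Site d) (r : ℝ≥0∞) :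
    Set (Site d) :=
  {x | edist x z < r ∧ μ (rivals R z x) = 0}

/-- The sites within the radius of some center. -/
def reachedSites (μ : Measure (Site d)) (R : Site d → ℝ≥0∞) : Set (Site d) :=
  {x | μ {η | edist x η < R η} ≠ 0}

/-- The volume that `z` receives when the centers have the radii `R`. -/
noncomputable def load (μ : Measure (Site d)) (R : Site d → ℝ≥0∞) (z : Site d) : ℝ≥0∞ :=
  volume (availableSites μ R z (R z))

/-- Every center receives at most `α`, and exactly `α` if its radius is finite. -/
def IsStableRadii (S : Set (Site d)) (μ : Measure (Site d)) (α : ℝ≥0∞) (R : Site d → ℝ≥0∞) :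
    Prop :=
  ∀ z ∈ S, load μ R z ≤ α ∧ (R z ≠ ∞ → load μ R z = α)

namespace CountsLocallyFinite

theorem countable (h : CountsLocallyFinite S μ) : S.Countable := by
  have : S = ⋃ n : ℕ, S ∩ Metric.closedBall 0 n := by
    rw [← Set.inter_iUnion, Metric.iUnion_closedBall_nat, Set.inter_univ]
  rw [this]
  exact Set.countable_iUnion fun n => (h.finite_inter _ Metric.isBounded_closedBall).countable

theorem apply (h : CountsLocallyFinite S μ) (T : Set (Site d)) :
    μ T = Measure.count (T ∩ S) := by
  rw [h.eq_restrict, Measure.restrict_apply' h.countable.measurableSet]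

theorem apply_eq_zero_iff (h : CountsLocallyFinite S μ) {T : Set (Site d)} :
    μ T = 0 ↔ ∀ η ∈ S, η ∉ T := by
  rw [h.apply, Measure.count_eq_zero_iff, Set.eq_empty_iff_forall_notMem]
  exact ⟨fun h η hS hT => h η ⟨hT, hS⟩, fun h η hη => h η hη.2 hη.1⟩

theorem ae_iff (h : CountsLocallyFinite S μ) {p : Site d → Prop} :
    (∀ᵐ z ∂μ, p z) ↔ ∀ z ∈ S, p z := by
  simp [MeasureTheory.ae_iff, h.apply_eq_zero_iff]

theorem pointSupport_eq (h : CountsLocallyFinite S μ) : pointSupport μ = S := by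
  ext z
  by_cases hz : z ∈ S
  · simp [pointSupport, h.apply, hz]
  · simp [pointSupport, h.apply, hz]

theorem apply_lt_top (h : CountsLocallyFinite S μ) {B : Set (Site d)}
    (hB : Bornology.IsBounded B) : μ B < ∞ := by
  rw [h.apply, Measure.count_apply_lt_top, Set.inter_comm]
  exact h.finite_inter B hB

theorem mem_availableSites (h : CountsLocallyFinite S μ) {z x : Site d} {r : ℝ≥0∞} :
    x ∈ availableSites μ R z r ↔
      edist x z < r ∧ ∀ η ∈ S, edist x η < R η → edist x z ≤ edist x η := by
  simp [availableSites, h.apply_eq_zero_iff, rivals]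

theorem mem_reachedSites (h : CountsLocallyFinite S μ) {x : Site d} :
    x ∈ reachedSites μ R ↔ ∃ η ∈ S, edist x η < R η := by
  simp [reachedSites, h.apply_eq_zero_iff]

theorem measurableSet_availableSites (h : CountsLocallyFinite S μ) (z : Site d) (r : ℝ≥0∞) :
    MeasurableSet (availableSites μ R z r) := by
  have : availableSites μ R z r = {x | edist x z < r} ∩
      ⋂ η ∈ S, ({x | edist x η < R η}ᶜ ∪ {x | edist x z ≤ edist x η}) := by
    ext x
    simp [h.mem_availableSites, imp_iff_not_or]
  rw [this]
  refine (measurableSet_lt (by fun_prop) (by fun_prop)).inter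
    (MeasurableSet.biInter h.countable fun η _ => ?_)
  exact (measurableSet_lt (by fun_prop) (by fun_prop)).compl.union
    (measurableSet_le (by fun_prop) (by fun_prop))

theorem finite_near (h : CountsLocallyFinite S μ) (x : Site d) {r : ℝ≥0∞} (hr : r ≠ ∞) :
    {η ∈ S | edist x η < r}.Finite := by
  refine (h.finite_inter (Metric.ball x r.toReal) Metric.isBounded_ball).subset fun η hη => ?_
  refine ⟨hη.1, ?_⟩
  rw [← Metric.eball_ofReal, ENNReal.ofReal_toReal hr, Metric.mem_eball, edist_comm]
  exact hη.2

/-- Spheres are null, and there are countably many centers. Dimension at least 1 matters: for `d =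
0` the sphere of radius 0 has volume 1. -/
theorem ae_edist_ne (h : CountsLocallyFinite S μ) (hd : 1 ≤ d) (R : Site d → ℝ≥0∞) :
    ∀ᵐ x : Site d, ∀ η ∈ S, edist x η ≠ R η := by
  have : Nonempty (Fin d) := ⟨⟨0, hd⟩⟩
  refine (ae_ball_iff h.countable).2 fun η _ => ?_
  rw [MeasureTheory.ae_iff]
  by_cases hR : R η = ∞
  · simp [hR, edist_ne_top]
  · refine measure_mono_null (t := Metric.sphere η (R η).toReal) (fun x hx => ?_)
      (Measure.addHaar_sphere _ _ _)
    simp only [ne_eq, not_not, Set.mem_ofPred_eq] at hx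
    rw [Metric.mem_sphere, ← hx, edist_dist, ENNReal.toReal_ofReal dist_nonneg]

theorem ae_edist_injOn (h : CountsLocallyFinite S μ) :
    ∀ᵐ x : Site d, ∀ η ∈ S, ∀ ζ ∈ S, edist x η = edist x ζ → η = ζ := by
  refine (ae_ball_iff h.countable).2 fun η _ => (ae_ball_iff h.countable).2 fun ζ _ => ?_
  by_cases hne : η = ζ
  · simp [hne]
  rw [MeasureTheory.ae_iff]
  refine measure_mono_null (t := (AffineSubspace.perpBisector η ζ : Set (Site d)))
    (fun x hx => ?_) (Measure.addHaar_affineSubspace _ _ fun h => ?_)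
  · simp only [hne, imp_false, not_not, Set.mem_ofPred_eq] at hx
    rw [edist_dist, edist_dist, ENNReal.ofReal_eq_ofReal_iff dist_nonneg dist_nonneg] at hx
    exact AffineSubspace.mem_perpBisector_iff_dist_eq.2 hx
  · exact hne (AffineSubspace.perpBisector_eq_top.1 h)

theorem availableSites_anti (h : CountsLocallyFinite S μ) (hR : ∀ η ∈ S, R η ≤ R' η)
    (z : Site d) (r : ℝ≥0∞) : availableSites μ R' z r ⊆ availableSites μ R z r := fun x hx => by
  rw [h.mem_availableSites] at hx ⊢
  exact ⟨hx.1, fun η hη hlt => hx.2 η hη (hlt.trans_le (hR η hη))⟩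

end CountsLocallyFinite

theorem availableSites_mono (μ : Measure (Site d)) (R : Site d → ℝ≥0∞) (z : Site d) :
    Monotone (availableSites μ R z) := by
  intro r s hr x hx
  exact ⟨hx.1.trans_le hr, hx.2⟩

theorem availableSites_subset_of_le (μ : Measure (Site d)) (hR : R ≤ R') (z : Site d)
    (r : ℝ≥0∞) : availableSites μ R' z r ⊆ availableSites μ R z r := fun x hx => by
  have : rivals R z x ⊆ rivals R' z x := fun η hη => ⟨hη.1.trans_le (hR η), hη.2⟩
  exact ⟨hx.1, measure_mono_null this hx.2⟩

theorem volume_availableSites_ne_top (μ : Measure (Site d)) (R : Site d → ℝ≥0∞) (z : Site d)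
    {r : ℝ≥0∞} (hr : r ≠ ∞) : volume (availableSites μ R z r) ≠ ∞ := by
  refine ((measure_mono (t := Metric.ball z r.toReal) fun x hx => ?_).trans_lt
    measure_ball_lt_top).ne
  rw [← Metric.eball_ofReal, ENNReal.ofReal_toReal hr]
  exact hx.1

/-- Left continuity of the available volume in the radius, including at `r = ∞`: the open-ball
condition makes the sets an increasing union. -/
theorem volume_availableSites_le (μ : Measure (Site d)) (R : Site d → ℝ≥0∞) (z : Site d)
    {r : ℝ≥0∞} (hV : ∀ s < r, volume (availableSites μ R z s) ≤ α) :
    volume (availableSites μ R z r) ≤ α := by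
  have : availableSites μ R z r =
      ⋃ q : {q : ℚ // (Real.toNNReal q : ℝ≥0∞) < r}, availableSites μ R z (Real.toNNReal q) := by
    ext x
    simp only [Set.mem_iUnion]
    refine ⟨fun hx => ?_, fun ⟨q, hq⟩ => availableSites_mono μ R z q.2.le hq⟩
    obtain ⟨q, -, hxq, hqr⟩ := ENNReal.lt_iff_exists_rat_btwn.1 hx.1
    exact ⟨⟨q, hqr⟩, hxq, hx.2⟩
  rw [this, Directed.measure_iUnion]
  · exact iSup_le fun q => hV _ q.2
  · refine Monotone.directed_le fun p q hpq => availableSites_mono μ R z ?_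
    have : (p.1 : ℝ) ≤ q.1 := by exact_mod_cast hpq
    gcongr

/-- Right continuity at a finite radius: the sets at larger rational radii have finite volume and
shrink to the set at `r`, up to a part of a null sphere. -/
theorem CountsLocallyFinite.le_volume_availableSites (h : CountsLocallyFinite S μ) (hd : 1 ≤ d)
    {z : Site d} {r : ℝ≥0∞} (hr : r ≠ ∞)
    (hV : ∀ q : ℚ, r < (Real.toNNReal q : ℝ≥0∞) →
      α ≤ volume (availableSites μ R z (Real.toNNReal q))) :
    α ≤ volume (availableSites μ R z r) := by
  have : Nonempty (Fin d) := ⟨⟨0, hd⟩⟩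
  have hne : Nonempty {q : ℚ // r < (Real.toNNReal q : ℝ≥0∞)} := by
    obtain ⟨q, -, hq, -⟩ := ENNReal.lt_iff_exists_rat_btwn.1 (lt_top_iff_ne_top.2 hr)
    exact ⟨⟨q, hq⟩⟩
  have hsub : (⋂ q : {q : ℚ // r < (Real.toNNReal q : ℝ≥0∞)},
      availableSites μ R z (Real.toNNReal q)) ⊆
        availableSites μ R z r ∪ Metric.sphere z r.toReal := by
    intro x hx
    rw [Set.mem_iInter] at hx
    have hle : edist x z ≤ r := by
      by_contra! hlt
      obtain ⟨q, -, hrq, hqx⟩ := ENNReal.lt_iff_exists_rat_btwn.1 hlt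
      exact (hx ⟨q, hrq⟩).1.not_gt hqx
    rcases hle.lt_or_eq with hlt | heq
    · exact Or.inl ⟨hlt, (hx hne.some).2⟩
    · right
      rw [Metric.mem_sphere, ← heq, edist_dist, ENNReal.toReal_ofReal dist_nonneg]
  calc α ≤ ⨅ q : {q : ℚ // r < (Real.toNNReal q : ℝ≥0∞)},
        volume (availableSites μ R z (Real.toNNReal q)) := le_iInf fun q => hV _ q.2
    _ = volume (⋂ q : {q : ℚ // r < (Real.toNNReal q : ℝ≥0∞)},
        availableSites μ R z (Real.toNNReal q)) := by
      rw [Directed.measure_iInter]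
      · exact fun q => (h.measurableSet_availableSites _ _).nullMeasurableSet
      · refine Monotone.directed_ge fun p q hpq => availableSites_mono μ R z ?_
        have : (p.1 : ℝ) ≤ q.1 := by exact_mod_cast hpq
        gcongr
      · exact ⟨hne.some, volume_availableSites_ne_top _ _ _ ENNReal.coe_ne_top⟩
    _ ≤ volume (availableSites μ R z r ∪ Metric.sphere z r.toReal) := measure_mono hsub
    _ ≤ volume (availableSites μ R z r) + volume (Metric.sphere z r.toReal) :=
      measure_union_le _ _
    _ = volume (availableSites μ R z r) := by rw [Measure.addHaar_sphere, add_zero]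

/-! ### Extremal stable radii by monotone iteration. -/

/-- The largest radius for which the volume available to `z` lies in the set `C`. -/
noncomputable def radiusStep (C : Set ℝ≥0∞) (μ : Measure (Site d)) (R : Site d → ℝ≥0∞)
    (z : Site d) : ℝ≥0∞ :=
  ⨆ q : ℚ, ⨆ _ : volume (availableSites μ R z (Real.toNNReal q)) ∈ C, (Real.toNNReal q : ℝ≥0∞)

/-- Larger radii leave fewer sites available, so a center can extend further before its volume
leaves the lower set `C`. -/
theorem radiusStep_mono {C : Set ℝ≥0∞} (hC : IsLowerSet C) (μ : Measure (Site d)) :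
    Monotone (radiusStep C μ) := fun R R' hR z => by
  refine iSup_mono fun q => iSup_mono' fun hq => ⟨hC ?_ hq, le_rfl⟩
  exact measure_mono (availableSites_subset_of_le μ hR z _)

theorem CountsLocallyFinite.radiusStep_le (h : CountsLocallyFinite S μ) {C : Set ℝ≥0∞}
    (hC : IsLowerSet C) (hR : ∀ η ∈ S, R η ≤ R' η) (z : Site d) :
    radiusStep C μ R z ≤ radiusStep C μ R' z := by
  refine iSup_mono fun q => iSup_mono' fun hq => ⟨hC ?_ hq, le_rfl⟩
  exact measure_mono (h.availableSites_anti hR z _)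

theorem mem_of_lt_radiusStep {C : Set ℝ≥0∞} (hC : IsLowerSet C) {z : Site d} {s : ℝ≥0∞}
    (hs : s < radiusStep C μ R z) : volume (availableSites μ R z s) ∈ C := by
  simp only [radiusStep, lt_iSup_iff] at hs
  obtain ⟨q, hq, hsq⟩ := hs
  exact hC (measure_mono (availableSites_mono μ R z hsq.le)) hq

theorem notMem_of_radiusStep_lt {C : Set ℝ≥0∞} {z : Site d} {q : ℚ}
    (hq : radiusStep C μ R z < Real.toNNReal q) :
    volume (availableSites μ R z (Real.toNNReal q)) ∉ C := fun hC =>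
  hq.not_ge (le_iSup₂_of_le q hC le_rfl)

theorem radiusStep_le_of_forall {C : Set ℝ≥0∞} {z : Site d} {r : ℝ≥0∞}
    (hr : ∀ s, r < s → s ≠ ∞ → volume (availableSites μ R z s) ∉ C) :
    radiusStep C μ R z ≤ r := by
  refine iSup₂_le fun q hq => ?_
  by_contra! hlt
  exact hr _ hlt ENNReal.coe_ne_top hq

theorem le_radiusStep_of_mem {C : Set ℝ≥0∞} (hC : IsLowerSet C) {z : Site d} {r : ℝ≥0∞}
    (hr : volume (availableSites μ R z r) ∈ C) : r ≤ radiusStep C μ R z := by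
  by_contra! hlt
  obtain ⟨q, -, hq, hqr⟩ := ENNReal.lt_iff_exists_rat_btwn.1 hlt
  exact notMem_of_radiusStep_lt hq (hC (measure_mono (availableSites_mono μ R z hqr.le)) hr)

/-- The greatest stable radii, approximated from above. -/
noncomputable def greatestRadii (α : ℝ≥0∞) (μ : Measure (Site d)) (z : Site d) : ℝ≥0∞ :=
  ⨅ n : ℕ, (radiusStep (Set.Iic α) μ)^[n] ⊤ z

/-- The least stable radii, approximated from below. -/
noncomputable def leastRadii (α : ℝ≥0∞) (μ : Measure (Site d)) (z : Site d) : ℝ≥0∞ :=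
  ⨆ n : ℕ, (radiusStep (Set.Iio α) μ)^[n] ⊥ z

theorem radiusStep_greatestRadii_le (α : ℝ≥0∞) (μ : Measure (Site d)) :
    radiusStep (Set.Iic α) μ (greatestRadii α μ) ≤ greatestRadii α μ := fun z => by
  refine le_iInf fun n => ?_
  cases n with
  | zero => exact le_top
  | succ n =>
    rw [Function.iterate_succ_apply']
    exact radiusStep_mono (isLowerSet_Iic α) μ (fun η => iInf_le _ n) z

theorem le_radiusStep_leastRadii (α : ℝ≥0∞) (μ : Measure (Site d)) :
    leastRadii α μ ≤ radiusStep (Set.Iio α) μ (leastRadii α μ) := fun z => by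
  refine iSup_le fun n => ?_
  cases n with
  | zero => exact bot_le
  | succ n =>
    rw [Function.iterate_succ_apply']
    exact radiusStep_mono (isLowerSet_Iio α) μ
      (fun η => le_iSup (fun n => (radiusStep (Set.Iio α) μ)^[n] ⊥ η) n) z

/-- Monotonicity alone makes the limit a pre-fixed point, which gives load at least `α` at finite
radii. The upper bound needs continuity of the available volume along the decreasing iteration. -/
theorem CountsLocallyFinite.isStableRadii_greatestRadii (h : CountsLocallyFinite S μ)
    (hd : 1 ≤ d) (α : ℝ≥0∞) : IsStableRadii S μ α (greatestRadii α μ) := by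
  intro z _
  have hanti : Antitone fun n => (radiusStep (Set.Iic α) μ)^[n] ⊤ :=
    (radiusStep_mono (isLowerSet_Iic α) μ).antitone_iterate_of_map_le le_top
  have hle : load μ (greatestRadii α μ) z ≤ α := by
    refine volume_availableSites_le _ _ _ fun s hs => ?_
    have hmono : Monotone fun n => availableSites μ ((radiusStep (Set.Iic α) μ)^[n] ⊤) z s :=
      fun m n hmn => availableSites_subset_of_le μ (hanti hmn) z s
    calc volume (availableSites μ (greatestRadii α μ) z s)
        ≤ volume (⋃ n, availableSites μ ((radiusStep (Set.Iic α) μ)^[n] ⊤) z s) := by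
          -- Only almost everywhere: a decreasing limit of radii can equal the distance from `x` to
          -- a center while all iterates exceed it.
          refine measure_mono_ae ?_
          filter_upwards [h.ae_edist_ne hd (greatestRadii α μ)] with x hx hxA
          have hxA' := h.mem_availableSites.1 hxA
          suffices ∀ᶠ n in Filter.atTop, ∀ η ∈ {η ∈ S | edist x η < edist x z},
              (radiusStep (Set.Iic α) μ)^[n] ⊤ η ≤ edist x η by
            obtain ⟨n, hn⟩ := this.exists
            refine Set.mem_iUnion.2 ⟨n, h.mem_availableSites.2 ⟨hxA'.1, fun η hη hlt => ?_⟩⟩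
            by_contra! hcl
            exact hlt.not_ge (hn η ⟨hη, hcl⟩)
          -- Only finitely many centers are closer to `x` than `z`, so one `n` works for all of
          -- them.
          rw [(h.finite_near x (edist_ne_top x z)).eventually_all]
          intro η hη
          have hlt : greatestRadii α μ η < edist x η := by
            refine lt_of_le_of_ne ?_ (hx η hη.1).symm
            by_contra! hlt
            exact (hxA'.2 η hη.1 hlt).not_gt hη.2
          obtain ⟨n, hn⟩ := iInf_lt_iff.1 hlt
          filter_upwards [Filter.eventually_ge_atTop n] with m hm
          exact (hanti hm η).trans hn.le
      _ ≤ α := by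
          rw [hmono.measure_iUnion]
          refine iSup_le fun n => ?_
          have := hs.trans_le (iInf_le _ (n + 1))
          rw [Function.iterate_succ_apply'] at this
          exact mem_of_lt_radiusStep (isLowerSet_Iic α) this
  refine ⟨hle, fun hfin => hle.antisymm (h.le_volume_availableSites hd hfin fun q hq => ?_)⟩
  have := notMem_of_radiusStep_lt ((radiusStep_greatestRadii_le α μ z).trans_lt hq)
  exact (not_le.1 this).le

/-- Dual to the greatest radii: here the upper bound on the load follows from monotonicity, and the
lower bound from continuity along the iteration. -/
theorem CountsLocallyFinite.isStableRadii_leastRadii (h : CountsLocallyFinite S μ)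
    (hd : 1 ≤ d) (α : ℝ≥0∞) : IsStableRadii S μ α (leastRadii α μ) := by
  intro z _
  have hmon : Monotone fun n => (radiusStep (Set.Iio α) μ)^[n] ⊥ :=
    (radiusStep_mono (isLowerSet_Iio α) μ).monotone_iterate_of_le_map bot_le
  have hle : load μ (leastRadii α μ) z ≤ α :=
    volume_availableSites_le _ _ _ fun s hs =>
      (Set.mem_Iio.1 (mem_of_lt_radiusStep (isLowerSet_Iio α)
        (hs.trans_le (le_radiusStep_leastRadii α μ z)))).le
  refine ⟨hle, fun hfin => hle.antisymm (h.le_volume_availableSites hd hfin fun q hq => ?_)⟩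
  -- No null set is needed: a distance strictly below a supremum of radii is below some iterate.
  have hsub : (⋂ n, availableSites μ ((radiusStep (Set.Iio α) μ)^[n] ⊥) z (Real.toNNReal q)) ⊆
      availableSites μ (leastRadii α μ) z (Real.toNNReal q) := by
    intro x hx
    simp only [Set.mem_iInter, h.mem_availableSites] at hx
    refine h.mem_availableSites.2 ⟨(hx 0).1, fun η hη hlt => ?_⟩
    obtain ⟨n, hn⟩ := lt_iSup_iff.1 hlt
    exact (hx n).2 η hη hn
  refine le_trans ?_ (measure_mono hsub)
  rw [Antitone.measure_iInter (fun m n hmn => availableSites_subset_of_le μ (hmon hmn) z _)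
    (fun n => (h.measurableSet_availableSites _ _).nullMeasurableSet)
    ⟨0, volume_availableSites_ne_top _ _ _ ENNReal.coe_ne_top⟩]
  refine le_iInf fun n => ?_
  have hlt : (radiusStep (Set.Iio α) μ)^[n + 1] ⊥ z < Real.toNNReal q :=
    (le_iSup (fun n => (radiusStep (Set.Iio α) μ)^[n] ⊥ z) (n + 1)).trans_lt hq
  rw [Function.iterate_succ_apply'] at hlt
  exact not_lt.1 (notMem_of_radiusStep_lt hlt)

/-- Loads at most `α` make `R` a post-fixed point of the step with `Set.Iic α`, so `R` stays below
every iterate from `⊤`. -/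
theorem CountsLocallyFinite.le_greatestRadii (h : CountsLocallyFinite S μ)
    (hR : IsStableRadii S μ α R) {z : Site d} (hz : z ∈ S) : R z ≤ greatestRadii α μ z := by
  refine le_iInf fun n => ?_
  induction n generalizing z with
  | zero => exact le_top
  | succ n ih =>
    rw [Function.iterate_succ_apply']
    exact (le_radiusStep_of_mem (isLowerSet_Iic α) (hR z hz).1).trans
      (h.radiusStep_le (isLowerSet_Iic α) (fun η hη => ih hη) z)

/-- Beyond a finite stable radius the available volume is at least `α`, so the step with `Set.Iio α`
cannot pass `R`. -/
theorem CountsLocallyFinite.leastRadii_le (h : CountsLocallyFinite S μ)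
    (hR : IsStableRadii S μ α R) {z : Site d} (hz : z ∈ S) : leastRadii α μ z ≤ R z := by
  refine iSup_le fun n => ?_
  induction n generalizing z with
  | zero => exact bot_le
  | succ n ih =>
    rw [Function.iterate_succ_apply']
    refine (h.radiusStep_le (isLowerSet_Iio α) (fun η hη => ih hη) z).trans
      (radiusStep_le_of_forall fun s hs _ => ?_)
    rw [Set.mem_Iio, not_lt, ← (hR z hz).2 hs.ne_top]
    exact measure_mono (availableSites_mono μ R z hs.le)

/-! ### The radii of a stable allocation -/

open Classical in
/-- The distance up to which the center `ξ` covets sites. -/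
noncomputable def covetRadius (α : ℝ≥0∞) (ψ : Site d → Target d) (ξ : Site d) : ℝ≥0∞ :=
  if IsSated α ψ ξ then ⨆ x ∈ territory ψ ξ, edist x ξ else ∞

theorem edist_lt_edist_iff_dist_lt_dist {a b c e : Site d} :
    edist a b < edist c e ↔ dist a b < dist c e := by
  rw [edist_dist, edist_dist, ENNReal.ofReal_lt_ofReal_iff_of_nonneg dist_nonneg]

theorem IsAllocation.ae_ne_undefined {ψ : Site d → Target d} (hψ : IsAllocation S α ψ) :
    ∀ᵐ x, ψ x ≠ Target.undefined := by
  refine measure_mono_null (fun x hx => ?_) hψ.volume_undefined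
  exact not_not.1 hx

theorem covets_iff {ψ : Site d → Target d} {ξ x : Site d} :
    Covets α ψ ξ x ↔ edist x ξ < covetRadius α ψ ξ := by
  unfold Covets covetRadius
  split_ifs with hs
  · simp [hs, lt_iSup_iff, edist_lt_edist_iff_dist_lt_dist]
  · simp [hs, edist_lt_top]

theorem edist_le_covetRadius (α : ℝ≥0∞) {ψ : Site d → Target d} {ξ x : Site d}
    (hx : ψ x = Target.center ξ) : edist x ξ ≤ covetRadius α ψ ξ := by
  unfold covetRadius
  split_ifs with hs
  · exact le_iSup₂_of_le x hx le_rfl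
  · exact le_top

/-- Away from ties between centers and sites exactly at a covet radius, a mismatch between the two
sets would produce an unstable pair. -/
theorem CountsLocallyFinite.territory_ae_eq (h : CountsLocallyFinite S μ) (hd : 1 ≤ d)
    {ψ : Site d → Target d} (hψ : IsStableAllocation S α ψ) {ξ : Site d} (hξ : ξ ∈ S) :
    availableSites μ (covetRadius α ψ) ξ (covetRadius α ψ ξ) =ᵐ[volume] territory ψ ξ := by
  rw [Filter.eventuallyEq_set]
  filter_upwards [hψ.1.ae_ne_undefined, h.ae_edist_ne hd (covetRadius α ψ), h.ae_edist_injOn]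
    with x hxu hxR hxinj
  rw [h.mem_availableSites]
  constructor
  · rintro ⟨hlt, hriv⟩
    by_contra hne
    have hdes : ¬ Desires ψ x ξ := fun hdes =>
      hψ.2 x ξ hξ ⟨hne, hxu, hdes, covets_iff.2 hlt⟩
    match hx : ψ x with
    | .undefined => exact hxu hx
    | .unclaimed => exact hdes (Or.inr hx)
    | .center ζ =>
      have hζ : ζ ∈ S := hψ.1.center_mem x ζ hx
      have hle : edist x ζ ≤ edist x ξ := by
        by_contra! hcl
        exact hdes (Or.inl ⟨ζ, hx, edist_lt_edist_iff_dist_lt_dist.1 hcl⟩)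
      have heq := hle.antisymm
        (hriv ζ hζ ((edist_le_covetRadius α hx).lt_of_ne (hxR ζ hζ)))
      exact hne (hxinj ζ hζ ξ hξ heq ▸ hx)
  · intro hx
    refine ⟨(edist_le_covetRadius α hx).lt_of_ne (hxR ξ hξ), fun η hη hlt => ?_⟩
    by_contra! hcl
    have hne : ψ x ≠ Target.center η := fun hxη => by
      have : ξ = η := Target.center.inj ((show ψ x = Target.center ξ from hx).symm.trans hxη)
      exact hcl.ne (by rw [this])
    exact hψ.2 x η hη ⟨hne, hxu, Or.inl ⟨ξ, hx, edist_lt_edist_iff_dist_lt_dist.1 hcl⟩, covets_iff.2 hlt⟩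

theorem CountsLocallyFinite.load_covetRadius (h : CountsLocallyFinite S μ) (hd : 1 ≤ d)
    {ψ : Site d → Target d} (hψ : IsStableAllocation S α ψ) {ξ : Site d} (hξ : ξ ∈ S) :
    load μ (covetRadius α ψ) ξ = volume (territory ψ ξ) :=
  measure_congr (h.territory_ae_eq hd hψ hξ)

theorem CountsLocallyFinite.isStableRadii_covetRadius (h : CountsLocallyFinite S μ) (hd : 1 ≤ d)
    {ψ : Site d → Target d} (hψ : IsStableAllocation S α ψ) :
    IsStableRadii S μ α (covetRadius α ψ) := by
  intro ξ hξ
  rw [h.load_covetRadius hd hψ hξ]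
  refine ⟨hψ.1.volume_territory_le ξ hξ, fun hne => ?_⟩
  by_contra hs
  exact hne (if_neg hs)

theorem CountsLocallyFinite.compl_reachedSites_subset (h : CountsLocallyFinite S μ) (hd : 1 ≤ d)
    {ψ : Site d → Target d} (hψ : IsStableAllocation S α ψ) :
    ∀ᵐ x, x ∉ reachedSites μ (covetRadius α ψ) → x ∈ unclaimedSites ψ := by
  filter_upwards [hψ.1.ae_ne_undefined, h.ae_edist_ne hd (covetRadius α ψ)] with x hxu hxR hx
  rw [h.mem_reachedSites] at hx
  match hx' : ψ x with
  | .undefined => exact absurd hx' hxu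
  | .unclaimed => exact hx'
  | .center ζ =>
    have hζ : ζ ∈ S := hψ.1.center_mem x ζ hx'
    exact absurd ⟨ζ, hζ, (edist_le_covetRadius α hx').lt_of_ne (hxR ζ hζ)⟩ hx

theorem CountsLocallyFinite.ae_claimed (h : CountsLocallyFinite S μ)
    {ψ : Site d → Target d} (hψ : IsStableAllocation S α ψ) :
    ∀ᵐ x, x ∈ reachedSites μ (covetRadius α ψ) → IsClaimed ψ x := by
  filter_upwards [hψ.1.ae_ne_undefined] with x hxu hx
  obtain ⟨η, hη, hlt⟩ := h.mem_reachedSites.1 hx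
  match hx' : ψ x with
  | .undefined => exact absurd hx' hxu
  | .unclaimed =>
    exact absurd ⟨by simp [hx'], hxu, Or.inr hx', covets_iff.2 hlt⟩ (hψ.2 x η hη)
  | .center ζ => exact ⟨ζ, hx'⟩

/-! ### Comparing radii; almost every reached site has one owner. -/

theorem CountsLocallyFinite.reachedSites_mono (h : CountsLocallyFinite S μ)
    (hR : ∀ η ∈ S, R η ≤ R' η) : reachedSites μ R ⊆ reachedSites μ R' := fun x hx => by
  obtain ⟨η, hη, hlt⟩ := h.mem_reachedSites.1 hx
  exact h.mem_reachedSites.2 ⟨η, hη, hlt.trans_le (hR η hη)⟩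

theorem CountsLocallyFinite.reachedSites_eq_univ (h : CountsLocallyFinite S μ) {ξ : Site d}
    (hξ : ξ ∈ S) (hR : R ξ = ∞) : reachedSites μ R = Set.univ :=
  Set.eq_univ_of_forall fun x => h.mem_reachedSites.2 ⟨ξ, hξ, by simp [hR, edist_lt_top]⟩

/-- A center that is sated under the larger of two stable radii is sated under the smaller one. -/
theorem CountsLocallyFinite.load_eq_of_le (h : CountsLocallyFinite S μ)
    (hR : IsStableRadii S μ α R) (hle : ∀ η ∈ S, R η ≤ R' η) {ξ : Site d} (hξ : ξ ∈ S)
    (hload : load μ R' ξ = α) : load μ R ξ = α := by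
  by_cases hfin : R ξ = ∞
  · refine (hR ξ hξ).1.antisymm ?_
    -- Both radii of `ξ` are infinite, and fewer rivals under `R` leave `ξ` at least its `R'`-load.
    have : R' ξ = R ξ := by rw [hfin, ← top_le_iff, ← hfin]; exact hle ξ hξ
    rw [← hload, load, load, this]
    exact measure_mono (h.availableSites_anti hle ξ _)
  · exact (hR ξ hξ).2 hfin

theorem CountsLocallyFinite.availableSites_unique (h : CountsLocallyFinite S μ)
    (R : Site d → ℝ≥0∞) :
    ∀ᵐ x, μ {ξ | x ∈ availableSites μ R ξ (R ξ)} = (reachedSites μ R).indicator 1 x := by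
  filter_upwards [h.ae_edist_injOn] with x hinj
  by_cases hx : x ∈ reachedSites μ R
  · rw [Set.indicator_of_mem hx, Pi.one_apply]
    obtain ⟨η, hη, hlt⟩ := h.mem_reachedSites.1 hx
    have hne : {ζ ∈ S | edist x ζ < R ζ ∧ edist x ζ ≤ edist x η}.Nonempty :=
      ⟨η, hη, hlt, le_rfl⟩
    have hfin : {ζ ∈ S | edist x ζ < R ζ ∧ edist x ζ ≤ edist x η}.Finite := by
      refine (h.finite_near x (r := edist x η + 1)
        (ENNReal.add_ne_top.2 ⟨edist_ne_top _ _, ENNReal.one_ne_top⟩)).subset fun ζ hζ => ?_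
      exact ⟨hζ.1, hζ.2.2.trans_lt
        (ENNReal.lt_add_right (edist_ne_top _ _) one_ne_zero)⟩
    -- The owner of `x` is the nearest center among those reaching it.
    obtain ⟨ξ, hξ, hmin⟩ := Set.exists_min_image _ (fun ζ => edist x ζ) hfin hne
    have hmin' : ∀ ζ ∈ S, edist x ζ < R ζ → edist x ξ ≤ edist x ζ := fun ζ hζ hlt' => by
      rcases le_total (edist x ζ) (edist x η) with hle | hle
      · exact hmin ζ ⟨hζ, hlt', hle⟩
      · exact hξ.2.2.trans hle
    have : {ζ | x ∈ availableSites μ R ζ (R ζ)} ∩ S = {ξ} := by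
      ext ζ
      simp only [h.mem_availableSites, Set.mem_inter_iff, Set.mem_ofPred_eq,
        Set.mem_singleton_iff]
      constructor
      · rintro ⟨⟨hlt', hζ⟩, hζS⟩
        exact hinj ζ hζS ξ hξ.1 ((hζ ξ hξ.1 hξ.2.1).antisymm (hmin' ζ hζS hlt'))
      · rintro rfl
        exact ⟨⟨hξ.2.1, hmin'⟩, hξ.1⟩
    rw [h.apply, this, Measure.count_singleton]
  · rw [Set.indicator_of_notMem hx, h.apply_eq_zero_iff]
    intro ξ hξ hxA
    exact hx (h.mem_reachedSites.2 ⟨ξ, hξ, And.left hxA⟩)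

end Deterministic

/-! ### Translation equivariance. -/

section Equivariance

variable {d : ℕ}

theorem translateMeasure_apply (v : Site d) (μ : Measure (Site d)) (T : Set (Site d)) :
    translateMeasure v μ T = μ ((· + v) ⁻¹' T) :=
  (MeasurableEquiv.addRight v).map_apply T

theorem measurable_translateMeasure (v : Site d) :
    Measurable (translateMeasure v : Measure (Site d) → Measure (Site d)) :=
  Measure.measurable_map _ (by fun_prop)

theorem mem_availableSites_translate {μ : Measure (Site d)} {R R' : Site d → ℝ≥0∞} {v : Site d}
    (hR : ∀ η, R' (η + v) = R η) (z x : Site d) (r : ℝ≥0∞) :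
    x + v ∈ availableSites (translateMeasure v μ) R' (z + v) r ↔ x ∈ availableSites μ R z r := by
  have : (· + v) ⁻¹' rivals R' (z + v) (x + v) = rivals R z x := by
    ext η
    simp [rivals, hR, edist_add_right]
  simp [availableSites, translateMeasure_apply, this, edist_add_right]

theorem volume_availableSites_translate {μ : Measure (Site d)} {R R' : Site d → ℝ≥0∞}
    {v : Site d} (hR : ∀ η, R' (η + v) = R η) (z : Site d) (r : ℝ≥0∞) :
    volume (availableSites (translateMeasure v μ) R' (z + v) r) =
      volume (availableSites μ R z r) := by
  rw [← measure_preimage_add_right volume v]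
  congr 1
  ext x
  exact mem_availableSites_translate hR z x r

theorem mem_reachedSites_translate {μ : Measure (Site d)} {R R' : Site d → ℝ≥0∞} {v : Site d}
    (hR : ∀ η, R' (η + v) = R η) (x : Site d) :
    x + v ∈ reachedSites (translateMeasure v μ) R' ↔ x ∈ reachedSites μ R := by
  simp [reachedSites, translateMeasure_apply, edist_add_right, hR]

theorem radiusStep_translate {μ : Measure (Site d)} {R R' : Site d → ℝ≥0∞} {v : Site d}
    (hR : ∀ η, R' (η + v) = R η) (C : Set ℝ≥0∞) (z : Site d) :
    radiusStep C (translateMeasure v μ) R' (z + v) = radiusStep C μ R z := by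
  simp [radiusStep, volume_availableSites_translate hR]

theorem iterate_radiusStep_translate {μ : Measure (Site d)} {R R' : Site d → ℝ≥0∞} {v : Site d}
    (hR : ∀ η, R' (η + v) = R η) (C : Set ℝ≥0∞) (n : ℕ) (z : Site d) :
    (radiusStep C (translateMeasure v μ))^[n] R' (z + v) = (radiusStep C μ)^[n] R z := by
  induction n generalizing z with
  | zero => exact hR z
  | succ n ih =>
    rw [Function.iterate_succ_apply', Function.iterate_succ_apply', radiusStep_translate ih]

theorem greatestRadii_translate (α : ℝ≥0∞) (μ : Measure (Site d)) (v z : Site d) :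
    greatestRadii α (translateMeasure v μ) (z + v) = greatestRadii α μ z :=
  iInf_congr fun n => iterate_radiusStep_translate (fun _ => rfl) _ n z

theorem leastRadii_translate (α : ℝ≥0∞) (μ : Measure (Site d)) (v z : Site d) :
    leastRadii α (translateMeasure v μ) (z + v) = leastRadii α μ z :=
  iSup_congr fun n => iterate_radiusStep_translate (fun _ => rfl) _ n z

end Equivariance

/-! ### Joint measurability in the point measure and the site. -/

section Measurability

open ProbabilityTheory

variable {d : ℕ}

/-- The measures which are finite on bounded sets. -/
def locallyFiniteMeasures (d : ℕ) : Set (Measure (Site d)) :=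
  {μ | ∀ n : ℕ, μ (Metric.closedBall 0 n) < ∞}

theorem measurableSet_locallyFiniteMeasures : MeasurableSet (locallyFiniteMeasures d) := by
  rw [locallyFiniteMeasures, Set.ofPred_forall]
  exact MeasurableSet.iInter fun _ =>
    measurableSet_lt (Measure.measurable_coe Metric.isClosed_closedBall.measurableSet)
      measurable_const

theorem mem_locallyFiniteMeasures_iff {μ : Measure (Site d)} :
    μ ∈ locallyFiniteMeasures d ↔ ∀ B, Bornology.IsBounded B → μ B < ∞ := by
  refine ⟨fun h B hB => ?_, fun h n => h _ Metric.isBounded_closedBall⟩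
  obtain ⟨r, hr⟩ := hB.subset_closedBall 0
  obtain ⟨n, hn⟩ := exists_nat_ge r
  exact (measure_mono (hr.trans (Metric.closedBall_subset_closedBall hn))).trans_lt (h n)

theorem translateMeasure_mem_locallyFiniteMeasures (v : Site d) (μ : Measure (Site d)) :
    translateMeasure v μ ∈ locallyFiniteMeasures d ↔ μ ∈ locallyFiniteMeasures d := by
  simp only [mem_locallyFiniteMeasures_iff, translateMeasure_apply]
  refine ⟨fun h B hB => ?_, fun h B hB => h _ ?_⟩
  · have := h ((· + v) '' B) ((isometry_add_right v).lipschitz.isBounded_image hB)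
    rwa [Set.preimage_image_eq _ (add_left_injective v)] at this
  · have := (isometry_add_right (-v)).lipschitz.isBounded_image hB
    rwa [Set.image_add_right, neg_neg] at this

open Classical in
/-- The kernel which maps a locally finite measure to itself, and all other measures to `0`. -/
noncomputable def locallyFinitePart (d : ℕ) : Kernel (Measure (Site d)) (Site d) where
  toFun μ := if μ ∈ locallyFiniteMeasures d then μ else 0
  measurable' := Measurable.ite measurableSet_locallyFiniteMeasures measurable_id measurable_const

theorem locallyFinitePart_of_mem {μ : Measure (Site d)} (hμ : μ ∈ locallyFiniteMeasures d) :
    locallyFinitePart d μ = μ := if_pos hμ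

theorem CountsLocallyFinite.locallyFinitePart_eq {S : Set (Site d)} {μ : Measure (Site d)}
    (h : CountsLocallyFinite S μ) : locallyFinitePart d μ = μ :=
  locallyFinitePart_of_mem fun _ => h.apply_lt_top Metric.isBounded_closedBall

theorem locallyFinitePart_apply_lt_top (μ : Measure (Site d)) {B : Set (Site d)}
    (hB : Bornology.IsBounded B) : locallyFinitePart d μ B < ∞ := by
  by_cases hμ : μ ∈ locallyFiniteMeasures d
  · rw [locallyFinitePart_of_mem hμ]
    exact mem_locallyFiniteMeasures_iff.1 hμ B hB
  · rw [show locallyFinitePart d μ = 0 from if_neg hμ]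
    simp

theorem locallyFinitePart_translate (v : Site d) (μ : Measure (Site d)) :
    locallyFinitePart d (translateMeasure v μ) = translateMeasure v (locallyFinitePart d μ) := by
  by_cases hμ : μ ∈ locallyFiniteMeasures d
  · rw [locallyFinitePart_of_mem hμ, locallyFinitePart_of_mem
      ((translateMeasure_mem_locallyFiniteMeasures v μ).2 hμ)]
  · rw [show locallyFinitePart d μ = 0 from if_neg hμ,
      show locallyFinitePart d (translateMeasure v μ) = 0 from
        if_neg (mt (translateMeasure_mem_locallyFiniteMeasures v μ).1 hμ)]
    simp [translateMeasure]

/-- Cut the parameter space according to the integer part of the total mass; each piece is a finite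
kernel. -/
theorem isSFiniteKernel_of_forall_apply_univ_lt_top {X Y : Type*} [MeasurableSpace X]
    [MeasurableSpace Y] (κ : Kernel X Y) (hκ : ∀ x, κ x Set.univ < ∞) : IsSFiniteKernel κ := by
  classical
  have hmeas : Measurable fun x => κ x Set.univ := κ.measurable_coe MeasurableSet.univ
  have hs : ∀ k : ℕ, MeasurableSet {x | ⌊(κ x Set.univ).toNNReal⌋₊ = k} := fun k =>
    (Nat.measurable_floor.comp hmeas.ennreal_toNNReal) (measurableSet_singleton k)
  have heq : κ = Kernel.sum fun k : ℕ => Kernel.piecewise (hs k) κ 0 := by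
    ext x t ht
    rw [Kernel.sum_apply' _ _ ht, tsum_eq_single ⌊(κ x Set.univ).toNNReal⌋₊]
    · simp [Kernel.piecewise_apply]
    · intro k hk
      simp [Kernel.piecewise_apply, hk.symm]
  rw [heq]
  refine Kernel.isSFiniteKernel_sum (hκs := fun k => ?_)
  have : IsFiniteKernel (Kernel.piecewise (hs k) κ 0) := by
    refine ⟨⟨k + 1, by simp, fun x => ?_⟩⟩
    rw [Kernel.piecewise_apply]
    split_ifs with hx
    · have hx' : ⌊(κ x Set.univ).toNNReal⌋₊ = k := hx
      rw [← ENNReal.coe_toNNReal (hκ x).ne]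
      have := (Nat.lt_floor_add_one (κ x Set.univ).toNNReal).le
      rw [hx'] at this
      exact_mod_cast this
    · simp
  infer_instance

instance : IsSFiniteKernel (locallyFinitePart d) := by
  have hs : ∀ n : ℕ, MeasurableSet {x : Site d | ⌊‖x‖⌋₊ = n} := fun n =>
    (Nat.measurable_floor.comp measurable_norm) (measurableSet_singleton n)
  have heq : locallyFinitePart d =
      Kernel.sum fun n : ℕ => (locallyFinitePart d).restrict (hs n) := by
    ext μ t ht
    rw [Kernel.sum_apply' _ _ ht]
    simp_rw [Kernel.restrict_apply' _ (hs _) _ ht]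
    rw [← measure_iUnion]
    · have : ⋃ n : ℕ, {x : Site d | ⌊‖x‖⌋₊ = n} = Set.univ :=
        Set.iUnion_eq_univ_iff.2 fun x => ⟨_, rfl⟩
      rw [← Set.inter_iUnion, this, Set.inter_univ]
    · refine fun m n hmn => Set.disjoint_left.2 fun x hx hx' => hmn ?_
      exact (show ⌊‖x‖⌋₊ = m from hx.2).symm.trans hx'.2
    · exact fun n => ht.inter (hs n)
  rw [heq]
  refine Kernel.isSFiniteKernel_sum (hκs := fun n =>
    isSFiniteKernel_of_forall_apply_univ_lt_top _ fun μ => ?_)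
  rw [Kernel.restrict_apply' _ (hs n) _ MeasurableSet.univ, Set.univ_inter]
  refine locallyFinitePart_apply_lt_top μ
    ((Metric.isBounded_closedBall (x := (0 : Site d)) (r := n + 1)).subset fun x hx => ?_)
  have hx' : ⌊‖x‖⌋₊ = n := hx
  rw [mem_closedBall_zero_iff, ← hx']
  exact (Nat.lt_floor_add_one _).le

theorem measurable_locallyFinitePart_apply {X : Type*} [MeasurableSpace X]
    {f : X → Measure (Site d)} (hf : Measurable f) {T : Set (X × Site d)} (hT : MeasurableSet T) :
    Measurable fun x => locallyFinitePart d (f x) {η | (x, η) ∈ T} :=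
  Kernel.measurable_kernel_prodMk_left (κ := (locallyFinitePart d).comap f hf) hT

theorem measurable_lintegral_locallyFinitePart {X : Type*} [MeasurableSpace X]
    {f : X → Measure (Site d)} (hf : Measurable f) {g : X → Site d → ℝ≥0∞}
    (hg : Measurable (Function.uncurry g)) :
    Measurable fun x => ∫⁻ η, g x η ∂(locallyFinitePart d (f x)) :=
  Measurable.lintegral_kernel_prod_right (κ := (locallyFinitePart d).comap f hf) hg

variable {R : Measure (Site d) → Site d → ℝ≥0∞}

/-- Availability is the vanishing of the mass of a measurable set of rivals, so kernel measurability
applies without choosing an enumeration of the centers. -/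
theorem measurableSet_availableSites (hR : Measurable (Function.uncurry R))
    {r : Measure (Site d) → Site d → ℝ≥0∞} (hr : Measurable (Function.uncurry r)) :
    MeasurableSet {p : (Measure (Site d) × Site d) × Site d |
      p.2 ∈ availableSites (locallyFinitePart d p.1.1) (R p.1.1) p.1.2 (r p.1.1 p.1.2)} := by
  refine (measurableSet_lt (f := fun p : (Measure (Site d) × Site d) × Site d =>
    edist p.2 p.1.2) (g := fun p => r p.1.1 p.1.2) (by fun_prop)
    (hr.comp measurable_fst)).inter ?_
  refine (measurable_locallyFinitePart_apply
    (f := fun p : (Measure (Site d) × Site d) × Site d => p.1.1) (by fun_prop)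
    (T := {q | edist q.1.2 q.2 < R q.1.1.1 q.2 ∧ edist q.1.2 q.2 < edist q.1.2 q.1.1.2}) ?_)
    (measurableSet_singleton 0)
  refine MeasurableSet.inter ?_ ?_
  · exact measurableSet_lt (by fun_prop)
      (hR.comp (measurable_fst.fst.fst.prodMk measurable_snd))
  · exact measurableSet_lt (f := fun q : ((Measure (Site d) × Site d) × Site d) × Site d =>
      edist q.1.2 q.2) (g := fun q => edist q.1.2 q.1.1.2) (by fun_prop) (by fun_prop)

theorem measurable_radiusStep (hR : Measurable (Function.uncurry R)) {C : Set ℝ≥0∞}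
    (hC : MeasurableSet C) :
    Measurable (Function.uncurry fun μ => radiusStep C (locallyFinitePart d μ) (R μ)) := by
  classical
  refine Measurable.iSup fun q => ?_
  simp_rw [iSup_eq_if]
  refine Measurable.ite ?_ measurable_const measurable_const
  exact (measurable_measure_prodMk_left (measurableSet_availableSites hR
    (r := fun _ _ => Real.toNNReal q) measurable_const)) hC

theorem measurable_iterate_radiusStep {C : Set ℝ≥0∞} (hC : MeasurableSet C) (c : ℝ≥0∞) (n : ℕ) :
    Measurable (Function.uncurry fun μ =>
      (radiusStep C (locallyFinitePart d μ))^[n] (fun _ => c)) := by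
  induction n with
  | zero => exact measurable_const
  | succ n ih =>
    simp_rw [Function.iterate_succ_apply']
    exact measurable_radiusStep ih hC

theorem measurable_greatestRadii (α : ℝ≥0∞) :
    Measurable (Function.uncurry fun μ : Measure (Site d) =>
      greatestRadii α (locallyFinitePart d μ)) :=
  Measurable.iInf fun n => measurable_iterate_radiusStep measurableSet_Iic ∞ n

theorem measurable_leastRadii (α : ℝ≥0∞) :
    Measurable (Function.uncurry fun μ : Measure (Site d) =>
      leastRadii α (locallyFinitePart d μ)) :=
  Measurable.iSup fun n => measurable_iterate_radiusStep measurableSet_Iio 0 n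

theorem measurableSet_reachedSites (hR : Measurable (Function.uncurry R)) :
    MeasurableSet {p : Measure (Site d) × Site d |
      p.2 ∈ reachedSites (locallyFinitePart d p.1) (R p.1)} := by
  refine (measurable_locallyFinitePart_apply
    (f := fun p : Measure (Site d) × Site d => p.1) (by fun_prop)
    (T := {q | edist q.1.2 q.2 < R q.1.1 q.2}) ?_) (measurableSet_singleton 0).compl
  exact measurableSet_lt (by fun_prop) (hR.comp (measurable_fst.fst.prodMk measurable_snd))

theorem measurable_load (hR : Measurable (Function.uncurry R)) :
    Measurable (Function.uncurry fun μ => load (locallyFinitePart d μ) (R μ)) :=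
  measurable_measure_prodMk_left (measurableSet_availableSites hR hR)

end Measurability

/-! ### Partition into lattice cubes. -/

section Cells

variable {d : ℕ}

/-- The unit cube with lower corner `u`. -/
def cell (u : Fin d → ℤ) : Set (Site d) :=
  {x | ∀ i, ⌊x i⌋ = u i}

/-- The lattice point `u` as a site. -/
def latticeSite (u : Fin d → ℤ) : Site d :=
  WithLp.toLp 2 fun i => (u i : ℝ)

theorem measurableSet_cell (u : Fin d → ℤ) : MeasurableSet (cell u) := by
  rw [cell, Set.ofPred_forall]
  refine MeasurableSet.iInter fun i => ?_
  have : Measurable fun x : Site d => ⌊x i⌋ := Int.measurable_floor.comp (by fun_prop)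
  exact this (measurableSet_singleton (u i))

theorem iUnion_cell : ⋃ u : Fin d → ℤ, cell u = Set.univ :=
  Set.iUnion_eq_univ_iff.2 fun x => ⟨fun i => ⌊x i⌋, fun _ => rfl⟩

theorem pairwise_disjoint_cell : Pairwise (Function.onFun Disjoint (cell : (Fin d → ℤ) → _)) :=
  fun _ _ huv => Set.disjoint_left.2 fun _ hu hv =>
    huv (funext fun i => (hu i).symm.trans (hv i))

theorem preimage_add_latticeSite_cell (u w : Fin d → ℤ) :
    (· + latticeSite u) ⁻¹' cell w = cell (w - u) := by
  ext x
  simp [cell, latticeSite, eq_sub_iff_add_eq]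

theorem cell_zero : cell (0 : Fin d → ℤ) = unitCube d := by
  ext x
  simp [cell, unitCube, Int.floor_eq_zero_iff]

theorem volume_cell_zero : volume (cell (0 : Fin d → ℤ)) = 1 := by
  have : cell (0 : Fin d → ℤ) = (WithLp.ofLp : Site d → Fin d → ℝ) ⁻¹'
      (Set.univ.pi fun _ => Set.Ico 0 1) := by
    ext x
    simp [cell, Int.floor_eq_zero_iff]
  rw [this, (PiLp.volume_preserving_ofLp (Fin d)).measure_preimage
    (MeasurableSet.univ_pi fun _ => measurableSet_Ico).nullMeasurableSet, Real.volume_pi_Ico]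
  simp

theorem isBounded_cell_zero : Bornology.IsBounded (cell (0 : Fin d → ℤ)) := by
  have h : Bornology.IsBounded (Set.univ.pi fun _ : Fin d => Set.Icc (0 : ℝ) 1) :=
    Bornology.IsBounded.pi fun _ => Metric.isBounded_Icc 0 1
  refine ((PiLp.antilipschitzWith_ofLp 2 fun _ : Fin d => ℝ).isBounded_preimage h).subset ?_
  intro x hx i _
  have := Int.floor_eq_zero_iff.1 (hx i)
  exact ⟨this.1, this.2.le⟩

theorem measure_eq_tsum_inter_cell (μ : Measure (Site d)) (A : Set (Site d)) :
    μ A = ∑' u : Fin d → ℤ, μ (A ∩ cell u) := by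
  have := lintegral_iUnion (μ := μ.restrict A) (fun u => measurableSet_cell u)
    pairwise_disjoint_cell 1
  simpa [iUnion_cell, Measure.restrict_apply (measurableSet_cell _), Set.inter_comm] using this

end Cells

/-! ### Equivariant stable radii and mass transport. -/

section MassTransport

variable {d : ℕ} {α : ℝ≥0∞} {R : Measure (Site d) → Site d → ℝ≥0∞}

/-- A measurable, translation-equivariant choice of stable radii. -/
structure IsRadiiField (α : ℝ≥0∞) (R : Measure (Site d) → Site d → ℝ≥0∞) : Prop where
  measurable : Measurable (Function.uncurry R)
  translate : ∀ v μ z, R (translateMeasure v μ) (z + v) = R μ z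
  stable : ∀ S μ, CountsLocallyFinite S μ → IsStableRadii S μ α (R μ)

theorem isRadiiField_greatestRadii (hd : 1 ≤ d) (α : ℝ≥0∞) :
    IsRadiiField α fun μ : Measure (Site d) => greatestRadii α (locallyFinitePart d μ) where
  measurable := measurable_greatestRadii α
  translate v μ z := by rw [locallyFinitePart_translate, greatestRadii_translate]
  stable S μ h := by
    rw [h.locallyFinitePart_eq]
    exact h.isStableRadii_greatestRadii hd α

theorem isRadiiField_leastRadii (hd : 1 ≤ d) (α : ℝ≥0∞) :
    IsRadiiField α fun μ : Measure (Site d) => leastRadii α (locallyFinitePart d μ) where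
  measurable := measurable_leastRadii α
  translate v μ z := by rw [locallyFinitePart_translate, leastRadii_translate]
  stable S μ h := by
    rw [h.locallyFinitePart_eq]
    exact h.isStableRadii_leastRadii hd α

/-- The territory that `R` assigns to `ξ`. -/
def fieldTerritory (R : Measure (Site d) → Site d → ℝ≥0∞) (μ : Measure (Site d)) (ξ : Site d) :
    Set (Site d) :=
  availableSites (locallyFinitePart d μ) (R μ) ξ (R μ ξ)

/-- The sites reached by some center under the radii `R`. -/
def fieldReached (R : Measure (Site d) → Site d → ℝ≥0∞) (μ : Measure (Site d)) : Set (Site d) :=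
  reachedSites (locallyFinitePart d μ) (R μ)

/-- The volume transported from the centers in `B` to the sites in `C`. -/
noncomputable def transport (R : Measure (Site d) → Site d → ℝ≥0∞) (B C : Set (Site d))
    (μ : Measure (Site d)) : ℝ≥0∞ :=
  ∫⁻ ξ in B, volume (fieldTerritory R μ ξ ∩ C) ∂(locallyFinitePart d μ)

/-- The sites which, as centers, do not receive the volume `α` under the radii `R`. -/
def fieldUnsated (α : ℝ≥0∞) (R : Measure (Site d) → Site d → ℝ≥0∞) (μ : Measure (Site d)) :
    Set (Site d) :=
  {ξ | volume (fieldTerritory R μ ξ) ≠ α}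

namespace IsRadiiField

theorem measurableSet_fieldTerritory (hR : IsRadiiField α R) :
    MeasurableSet {p : (Measure (Site d) × Site d) × Site d |
      p.2 ∈ fieldTerritory R p.1.1 p.1.2} :=
  measurableSet_availableSites hR.measurable hR.measurable

theorem measurableSet_fieldReached (hR : IsRadiiField α R) :
    MeasurableSet {p : Measure (Site d) × Site d | p.2 ∈ fieldReached R p.1} :=
  measurableSet_reachedSites hR.measurable

theorem measurableSet_fieldReached_apply (hR : IsRadiiField α R) (μ : Measure (Site d)) :
    MeasurableSet (fieldReached R μ) :=
  measurable_prodMk_left hR.measurableSet_fieldReached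

theorem measurable_volume_compl_fieldReached (hR : IsRadiiField α R) {C : Set (Site d)}
    (hC : MeasurableSet C) :
    Measurable fun μ => volume ((fieldReached R μ)ᶜ ∩ C) :=
  measurable_measure_prodMk_left
    (hR.measurableSet_fieldReached.compl.inter (measurable_snd hC))

theorem measurable_unsated (hR : IsRadiiField α R) {B : Set (Site d)} (hB : MeasurableSet B) :
    Measurable fun μ => locallyFinitePart d μ (fieldUnsated α R μ ∩ B) := by
  refine measurable_locallyFinitePart_apply measurable_id
    (T := {p | p.2 ∈ fieldUnsated α R p.1} ∩ Prod.snd ⁻¹' B) (MeasurableSet.inter ?_ ?_)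
  · exact (measurable_load hR.measurable) (measurableSet_singleton α).compl
  · exact measurable_snd hB

theorem measurable_transport (hR : IsRadiiField α R) {B C : Set (Site d)} (hB : MeasurableSet B)
    (hC : MeasurableSet C) : Measurable (transport R B C) := by
  unfold transport
  simp_rw [← lintegral_indicator hB]
  refine measurable_lintegral_locallyFinitePart measurable_id ?_
  have h : Measurable fun p : Measure (Site d) × Site d =>
      volume (fieldTerritory R p.1 p.2 ∩ C) :=
    measurable_measure_prodMk_left
      (hR.measurableSet_fieldTerritory.inter (measurable_snd hC))
  exact h.indicator (measurable_snd hB)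

theorem mem_fieldTerritory_translate (hR : IsRadiiField α R) (v : Site d) (μ : Measure (Site d))
    (ξ x : Site d) :
    x + v ∈ fieldTerritory R (translateMeasure v μ) (ξ + v) ↔ x ∈ fieldTerritory R μ ξ := by
  rw [fieldTerritory, locallyFinitePart_translate, mem_availableSites_translate
    (hR.translate v μ), hR.translate, fieldTerritory]

theorem volume_fieldTerritory_translate (hR : IsRadiiField α R) (v : Site d)
    (μ : Measure (Site d)) (ξ : Site d) (C : Set (Site d)) :
    volume (fieldTerritory R (translateMeasure v μ) (ξ + v) ∩ C) =
      volume (fieldTerritory R μ ξ ∩ (· + v) ⁻¹' C) := by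
  rw [← measure_preimage_add_right volume v]
  congr 1
  ext x
  exact and_congr_left' (hR.mem_fieldTerritory_translate v μ ξ x)

theorem volume_fieldReached_translate (hR : IsRadiiField α R) (v : Site d)
    (μ : Measure (Site d)) (C : Set (Site d)) :
    volume ((fieldReached R (translateMeasure v μ))ᶜ ∩ C) =
      volume ((fieldReached R μ)ᶜ ∩ (· + v) ⁻¹' C) := by
  rw [← measure_preimage_add_right volume v]
  congr 1
  ext x
  refine and_congr_left' (not_congr ?_)
  rw [fieldReached, locallyFinitePart_translate]
  exact mem_reachedSites_translate (hR.translate v μ) x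

theorem unsated_translate (hR : IsRadiiField α R) (v : Site d)
    (μ : Measure (Site d)) (B : Set (Site d)) :
    locallyFinitePart d (translateMeasure v μ) (fieldUnsated α R (translateMeasure v μ) ∩ B) =
      locallyFinitePart d μ (fieldUnsated α R μ ∩ (· + v) ⁻¹' B) := by
  rw [locallyFinitePart_translate, translateMeasure_apply]
  congr 1
  ext ξ
  refine and_congr_left' (not_congr ?_)
  have := hR.volume_fieldTerritory_translate v μ ξ Set.univ
  simp only [Set.preimage_univ, Set.inter_univ] at this
  rw [this]

theorem transport_translate (hR : IsRadiiField α R) (v : Site d) (μ : Measure (Site d))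
    (B C : Set (Site d)) :
    transport R B C (translateMeasure v μ) =
      transport R ((· + v) ⁻¹' B) ((· + v) ⁻¹' C) μ := by
  have he : MeasurableEmbedding fun x : Site d => x + v :=
    (MeasurableEquiv.addRight v).measurableEmbedding
  rw [transport, locallyFinitePart_translate, translateMeasure, he.restrict_map,
    he.lintegral_map, transport]
  exact lintegral_congr fun ξ => hR.volume_fieldTerritory_translate v μ ξ C

/-- Tonelli, since almost every reached site lies in the territory of exactly one center. -/
theorem transport_univ_left (hR : IsRadiiField α R) {S : Set (Site d)} {μ : Measure (Site d)}
    (h : CountsLocallyFinite S μ) {C : Set (Site d)} (hC : MeasurableSet C) :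
    transport R Set.univ C μ = volume (fieldReached R μ ∩ C) := by
  have hT : MeasurableSet {p : Site d × Site d | p.2 ∈ fieldTerritory R μ p.1 ∩ C} :=
    ((measurable_prodMk_left.comp measurable_fst).prodMk measurable_snd
      hR.measurableSet_fieldTerritory).inter (measurable_snd hC)
  calc transport R Set.univ C μ
      = (locallyFinitePart d μ).prod volume
          {p : Site d × Site d | p.2 ∈ fieldTerritory R μ p.1 ∩ C} := by
        rw [Measure.prod_apply hT, transport, Measure.restrict_univ]
        rfl
    _ = ∫⁻ x, C.indicator ((fieldReached R μ).indicator 1) x := by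
        rw [Measure.prod_apply_symm hT]
        refine lintegral_congr_ae ?_
        filter_upwards [h.availableSites_unique (R μ)] with x hx
        by_cases hxC : x ∈ C
        · simpa [hxC, fieldTerritory, fieldReached, h.locallyFinitePart_eq] using hx
        · simp [hxC]
    _ = volume (fieldReached R μ ∩ C) := by
        rw [Set.indicator_indicator, lintegral_indicator_one
          (hC.inter (hR.measurableSet_fieldReached_apply μ)), Set.inter_comm]

theorem transport_univ_right (R : Measure (Site d) → Site d → ℝ≥0∞) (B : Set (Site d))
    (μ : Measure (Site d)) :
    transport R B Set.univ μ =
      ∫⁻ ξ in B, volume (fieldTerritory R μ ξ) ∂(locallyFinitePart d μ) := by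
  simp [transport]

theorem transport_eq_tsum_left (R : Measure (Site d) → Site d → ℝ≥0∞) (C : Set (Site d))
    (μ : Measure (Site d)) :
    transport R Set.univ C μ = ∑' u : Fin d → ℤ, transport R (cell u) C μ := by
  rw [transport, ← iUnion_cell, lintegral_iUnion measurableSet_cell pairwise_disjoint_cell]
  rfl

theorem transport_eq_tsum_right (hR : IsRadiiField α R) {B : Set (Site d)} (μ : Measure (Site d)) :
    transport R B Set.univ μ = ∑' u : Fin d → ℤ, transport R B (cell u) μ := by
  unfold transport
  rw [← lintegral_tsum]
  · simp_rw [Set.inter_univ, ← measure_eq_tsum_inter_cell]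
  · intro u
    have h : Measurable fun p : Measure (Site d) × Site d =>
        volume (fieldTerritory R p.1 p.2 ∩ cell u) :=
      measurable_measure_prodMk_left
        (hR.measurableSet_fieldTerritory.inter (measurable_snd (measurableSet_cell u)))
    exact (h.comp measurable_prodMk_left).aemeasurable

end IsRadiiField

variable {Ω : Type*} [MeasurableSpace Ω] {P : Measure Ω} {N : Ω → Measure (Site d)}

theorem IsTranslationInvariant.lintegral_translate (hinv : IsTranslationInvariant P N)
    (hN : Measurable N) {F : Measure (Site d) → ℝ≥0∞} (hF : Measurable F) (v : Site d) :
    ∫⁻ ω, F (translateMeasure v (N ω)) ∂P = ∫⁻ ω, F (N ω) ∂P := by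
  rw [← lintegral_map hF hN, ← hinv v, lintegral_map hF (measurable_translateMeasure v)]
  exact (lintegral_map (hF.comp (measurable_translateMeasure v)) hN).symm

theorem IsTranslationInvariant.ae_translate (hinv : IsTranslationInvariant P N)
    (hN : Measurable N) {A : Set (Measure (Site d))} (hA : MeasurableSet A)
    (h : ∀ᵐ ω ∂P, N ω ∈ A) (v : Site d) : ∀ᵐ ω ∂P, translateMeasure v (N ω) ∈ A := by
  have h' : ∀ᵐ μ ∂(P.map N), μ ∈ A := (ae_map_iff hN.aemeasurable hA).2 h
  rw [← hinv v, Measure.map_map (measurable_translateMeasure v) hN] at h'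
  exact (ae_map_iff ((measurable_translateMeasure v).comp hN).aemeasurable hA).1 h'

theorem IsErgodic.ae_mem_or_ae_notMem [IsProbabilityMeasure P] (herg : IsErgodic P N)
    (hN : Measurable N) {A : Set (Measure (Site d))} (hA : MeasurableSet A)
    (hinv : ∀ v μ, translateMeasure v μ ∈ A ↔ μ ∈ A) :
    (∀ᵐ ω ∂P, N ω ∈ A) ∨ ∀ᵐ ω ∂P, N ω ∉ A := by
  have : IsProbabilityMeasure (P.map N) := Measure.isProbabilityMeasure_map hN.aemeasurable
  rcases herg.2 A hA fun v => Set.ext fun μ => hinv v μ with h | h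
  · exact Or.inr ((ae_map_iff hN.aemeasurable hA.compl).1 (measure_eq_zero_iff_ae_notMem.1 h))
  · exact Or.inl ((ae_map_iff hN.aemeasurable hA).1 ((mem_ae_iff_prob_eq_one hA).2 h))

/-- Mass transport principle: the expected mass received by a cell equals the expected mass sent
from a cell. -/
theorem IsRadiiField.lintegral_volume_fieldReached (hR : IsRadiiField α R)
    (hN : IsSimplePointProcess P N) (hinv : IsTranslationInvariant P N) :
    ∫⁻ ω, volume (fieldReached R (N ω) ∩ cell 0) ∂P =
      ∫⁻ ω, transport R (cell 0) Set.univ (N ω) ∂P := by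
  have hm : ∀ u w : Fin d → ℤ, Measurable (transport R (cell u) (cell w)) := fun u w =>
    hR.measurable_transport (measurableSet_cell u) (measurableSet_cell w)
  calc ∫⁻ ω, volume (fieldReached R (N ω) ∩ cell 0) ∂P
      = ∫⁻ ω, ∑' u : Fin d → ℤ, transport R (cell u) (cell 0) (N ω) ∂P := by
        refine lintegral_congr_ae ?_
        filter_upwards [hN.ae_simple] with ω ⟨S, hfin, heq⟩
        rw [← IsRadiiField.transport_eq_tsum_left,
          hR.transport_univ_left ⟨hfin, heq⟩ (measurableSet_cell 0)]
    _ = ∑' u : Fin d → ℤ, ∫⁻ ω, transport R (cell u) (cell 0) (N ω) ∂P :=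
        lintegral_tsum fun u => ((hm u 0).comp hN.measurable).aemeasurable
    _ = ∑' u : Fin d → ℤ, ∫⁻ ω, transport R (cell 0) (cell (-u)) (N ω) ∂P := by
        refine tsum_congr fun u => ?_
        rw [← hinv.lintegral_translate hN.measurable (hm u 0) (latticeSite u)]
        -- Translation turns the pair of cells `(u, 0)` into `(0, -u)`.
        simp_rw [hR.transport_translate, preimage_add_latticeSite_cell, sub_self, zero_sub]
    _ = ∑' u : Fin d → ℤ, ∫⁻ ω, transport R (cell 0) (cell u) (N ω) ∂P :=
        (Equiv.neg (Fin d → ℤ)).tsum_eq fun u =>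
          ∫⁻ ω, transport R (cell 0) (cell u) (N ω) ∂P
    _ = ∫⁻ ω, transport R (cell 0) Set.univ (N ω) ∂P := by
        simp_rw [hR.transport_eq_tsum_right]
        exact (lintegral_tsum fun u => ((hm 0 u).comp hN.measurable).aemeasurable).symm

end MassTransport

/-! ### The three phases for an equivariant field of radii. -/

section Phases

variable {d : ℕ} {α : ℝ≥0∞} {R : Measure (Site d) → Site d → ℝ≥0∞}

namespace IsRadiiField

section Pointwise

variable {S : Set (Site d)} {μ : Measure (Site d)}

theorem transport_le (hR : IsRadiiField α R) (h : CountsLocallyFinite S μ) :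
    transport R (cell 0) Set.univ μ ≤ α * μ (cell 0) := by
  rw [transport_univ_right, h.locallyFinitePart_eq, ← setLIntegral_const]
  refine lintegral_mono_ae (ae_restrict_of_ae (h.ae_iff.2 fun ξ hξ => ?_))
  rw [fieldTerritory, h.locallyFinitePart_eq]
  exact (hR.stable S μ h ξ hξ).1

theorem transport_eq (h : CountsLocallyFinite S μ)
    (hsat : locallyFinitePart d μ (fieldUnsated α R μ) = 0) :
    transport R (cell 0) Set.univ μ = α * μ (cell 0) := by
  rw [transport_univ_right, ← setLIntegral_const]
  rw [h.locallyFinitePart_eq] at hsat ⊢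
  refine lintegral_congr_ae (ae_restrict_of_ae ?_)
  simpa [ae_iff, fieldUnsated] using hsat

theorem unsated_eq_zero_iff (h : CountsLocallyFinite S μ) :
    locallyFinitePart d μ (fieldUnsated α R μ) = 0 ↔ ∀ ξ ∈ S, load μ (R μ) ξ = α := by
  rw [h.locallyFinitePart_eq, h.apply_eq_zero_iff]
  simp [fieldUnsated, fieldTerritory, h.locallyFinitePart_eq, load]

/-- An unsated center has infinite radius and would reach every site. -/
theorem unsated_eq_zero (hR : IsRadiiField α R) (h : CountsLocallyFinite S μ)
    (hne : volume (fieldReached R μ)ᶜ ≠ 0) :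
    locallyFinitePart d μ (fieldUnsated α R μ) = 0 := by
  refine (unsated_eq_zero_iff h).2 fun ξ hξ => (hR.stable S μ h ξ hξ).2 fun htop => hne ?_
  rw [fieldReached, h.locallyFinitePart_eq, h.reachedSites_eq_univ hξ htop]
  simp

end Pointwise

variable {Ω : Type*} [MeasurableSpace Ω] {P : Measure Ω} {N : Ω → Measure (Site d)}

theorem measurableSet_reached_conull (hR : IsRadiiField α R) :
    MeasurableSet {μ | volume (fieldReached R μ)ᶜ = 0} := by
  have := hR.measurable_volume_compl_fieldReached MeasurableSet.univ (measurableSet_singleton 0)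
  simp only [Set.inter_univ] at this
  exact this

theorem ae_volume_compl_of_cell (hR : IsRadiiField α R) (hN : Measurable N)
    (hinv : IsTranslationInvariant P N)
    (h : ∀ᵐ ω ∂P, volume ((fieldReached R (N ω))ᶜ ∩ cell 0) = 0) :
    ∀ᵐ ω ∂P, volume (fieldReached R (N ω))ᶜ = 0 := by
  have hall := ae_all_iff.2 fun u : Fin d → ℤ => hinv.ae_translate hN
    (hR.measurable_volume_compl_fieldReached (measurableSet_cell 0) (measurableSet_singleton 0))
    h (latticeSite (-u))
  filter_upwards [hall] with ω hω
  rw [measure_eq_tsum_inter_cell, ENNReal.tsum_eq_zero]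
  intro u
  have := hω u
  simpa [hR.volume_fieldReached_translate, preimage_add_latticeSite_cell] using this

theorem ae_unsated_of_cell (hR : IsRadiiField α R) (hN : Measurable N)
    (hinv : IsTranslationInvariant P N)
    (h : ∀ᵐ ω ∂P, locallyFinitePart d (N ω) (fieldUnsated α R (N ω) ∩ cell 0) = 0) :
    ∀ᵐ ω ∂P, locallyFinitePart d (N ω) (fieldUnsated α R (N ω)) = 0 := by
  have hall := ae_all_iff.2 fun u : Fin d → ℤ => hinv.ae_translate hN
    (hR.measurable_unsated (measurableSet_cell 0) (measurableSet_singleton 0))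
    h (latticeSite (-u))
  filter_upwards [hall] with ω hω
  rw [measure_eq_tsum_inter_cell, ENNReal.tsum_eq_zero]
  intro u
  have := hω u
  simpa [hR.unsated_translate, preimage_add_latticeSite_cell] using this

theorem ae_unsated_eq_zero (hR : IsRadiiField α R) (hN : IsSimplePointProcess P N)
    (h : ∀ᵐ ω ∂P, volume (fieldReached R (N ω))ᶜ ≠ 0) :
    ∀ᵐ ω ∂P, locallyFinitePart d (N ω) (fieldUnsated α R (N ω)) = 0 := by
  filter_upwards [hN.ae_simple, h] with ω ⟨S, hfin, heq⟩ hω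
  exact hR.unsated_eq_zero ⟨hfin, heq⟩ hω

theorem lintegral_mul_count {lam : ℝ≥0∞} (hN : Measurable N) (hint : intensity P N = lam) :
    ∫⁻ ω, α * N ω (cell 0) ∂P = lam * α := by
  have hm : Measurable fun ω => N ω (cell 0) :=
    (Measure.measurable_coe (measurableSet_cell 0)).comp hN
  rw [lintegral_const_mul _ hm, mul_comm, cell_zero, ← hint, intensity]

theorem lintegral_fieldReached_le (hR : IsRadiiField α R) (hN : IsSimplePointProcess P N)
    (hinv : IsTranslationInvariant P N) {lam : ℝ≥0∞} (hint : intensity P N = lam) :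
    ∫⁻ ω, volume (fieldReached R (N ω) ∩ cell 0) ∂P ≤ lam * α := by
  rw [hR.lintegral_volume_fieldReached hN hinv, ← lintegral_mul_count hN.measurable hint]
  refine lintegral_mono_ae ?_
  filter_upwards [hN.ae_simple] with ω ⟨S, hfin, heq⟩
  exact hR.transport_le ⟨hfin, heq⟩

theorem lintegral_fieldReached_eq (hR : IsRadiiField α R) (hN : IsSimplePointProcess P N)
    (hinv : IsTranslationInvariant P N) {lam : ℝ≥0∞} (hint : intensity P N = lam)
    (hsat : ∀ᵐ ω ∂P, locallyFinitePart d (N ω) (fieldUnsated α R (N ω)) = 0) :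
    ∫⁻ ω, volume (fieldReached R (N ω) ∩ cell 0) ∂P = lam * α := by
  rw [hR.lintegral_volume_fieldReached hN hinv, ← lintegral_mul_count hN.measurable hint]
  refine lintegral_congr_ae ?_
  filter_upwards [hN.ae_simple, hsat] with ω ⟨S, hfin, heq⟩ hω
  exact transport_eq ⟨hfin, heq⟩ hω

variable [IsProbabilityMeasure P]

theorem ae_conull_or (hR : IsRadiiField α R) (hN : Measurable N) (herg : IsErgodic P N) :
    (∀ᵐ ω ∂P, volume (fieldReached R (N ω))ᶜ = 0) ∨
      ∀ᵐ ω ∂P, volume (fieldReached R (N ω))ᶜ ≠ 0 := by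
  refine herg.ae_mem_or_ae_notMem hN hR.measurableSet_reached_conull fun v μ => ?_
  have := hR.volume_fieldReached_translate v μ Set.univ
  simp only [Set.preimage_univ, Set.inter_univ] at this
  simp [this]

theorem lintegral_fieldReached_of_conull
    (h : ∀ᵐ ω ∂P, volume (fieldReached R (N ω))ᶜ = 0) :
    ∫⁻ ω, volume (fieldReached R (N ω) ∩ cell 0) ∂P = 1 := by
  calc ∫⁻ ω, volume (fieldReached R (N ω) ∩ cell 0) ∂P = ∫⁻ _, 1 ∂P := by
        refine lintegral_congr_ae ?_
        filter_upwards [h] with ω hω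
        rw [← volume_cell_zero (d := d), Set.inter_comm]
        refine measure_inter_conull' (measure_mono_null ?_ hω)
        exact fun x hx => hx.2
    _ = 1 := by simp

theorem lintegral_fieldReached_le_one :
    ∫⁻ ω, volume (fieldReached R (N ω) ∩ cell 0) ∂P ≤ 1 := by
  calc ∫⁻ ω, volume (fieldReached R (N ω) ∩ cell 0) ∂P ≤ ∫⁻ _, 1 ∂P := by
        refine lintegral_mono fun ω => ?_
        rw [← volume_cell_zero (d := d)]
        exact measure_mono Set.inter_subset_right
    _ = 1 := by simp

/-- If the unreached volume were finite and nonzero, normalizing it would give a random probability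
measure whose expected mass is the same in each of infinitely many cells, yet sums to 1. -/
theorem ae_volume_compl_eq_top (hR : IsRadiiField α R) (hd : 1 ≤ d) (hN : Measurable N)
    (herg : IsErgodic P N) (h : ∀ᵐ ω ∂P, volume (fieldReached R (N ω))ᶜ ≠ 0) :
    ∀ᵐ ω ∂P, volume (fieldReached R (N ω))ᶜ = ∞ := by
  have : Nonempty (Fin d) := ⟨⟨0, hd⟩⟩
  have hmeas : Measurable fun μ : Measure (Site d) => volume (fieldReached R μ)ᶜ := by
    simpa using hR.measurable_volume_compl_fieldReached MeasurableSet.univ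
  have htrans : ∀ v μ, volume (fieldReached R (translateMeasure v μ))ᶜ =
      volume (fieldReached R μ)ᶜ := fun v μ => by
    simpa using hR.volume_fieldReached_translate v μ Set.univ
  refine (herg.ae_mem_or_ae_notMem hN (hmeas (measurableSet_singleton ∞))
    fun v μ => by simp [htrans]).resolve_right fun hfin => ?_
  have hm : ∀ u : Fin d → ℤ, Measurable fun μ =>
      volume ((fieldReached R μ)ᶜ ∩ cell u) / volume (fieldReached R μ)ᶜ := fun u =>
    (hR.measurable_volume_compl_fieldReached (measurableSet_cell u)).div hmeas
  have hconst : ∀ u : Fin d → ℤ,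
      ∫⁻ ω, volume ((fieldReached R (N ω))ᶜ ∩ cell u) / volume (fieldReached R (N ω))ᶜ ∂P =
        ∫⁻ ω, volume ((fieldReached R (N ω))ᶜ ∩ cell 0) / volume (fieldReached R (N ω))ᶜ ∂P := by
    intro u
    rw [← herg.1.lintegral_translate hN (hm u) (latticeSite u)]
    simp_rw [htrans, hR.volume_fieldReached_translate, preimage_add_latticeSite_cell, sub_self]
  have hsum : ∑' u : Fin d → ℤ,
      ∫⁻ ω, volume ((fieldReached R (N ω))ᶜ ∩ cell u) / volume (fieldReached R (N ω))ᶜ ∂P =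
        1 := by
    calc _ = ∫⁻ ω, ∑' u : Fin d → ℤ,
          volume ((fieldReached R (N ω))ᶜ ∩ cell u) / volume (fieldReached R (N ω))ᶜ ∂P :=
          (lintegral_tsum fun u => ((hm u).comp hN).aemeasurable).symm
      _ = ∫⁻ _, 1 ∂P := by
          refine lintegral_congr_ae ?_
          filter_upwards [h, hfin] with ω h0 htop
          simp_rw [div_eq_mul_inv]
          rw [ENNReal.tsum_mul_right, ← measure_eq_tsum_inter_cell]
          exact ENNReal.mul_inv_cancel h0 htop
      _ = 1 := by simp
  simp_rw [hconst] at hsum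
  by_cases h0 : ∫⁻ ω, volume ((fieldReached R (N ω))ᶜ ∩ cell 0) /
      volume (fieldReached R (N ω))ᶜ ∂P = 0
  · simp [h0] at hsum
  · rw [ENNReal.tsum_const_eq_top_of_ne_zero h0] at hsum
    exact ENNReal.top_ne_one hsum

theorem subcritical (hR : IsRadiiField α R) (hd : 1 ≤ d) (hN : IsSimplePointProcess P N)
    (herg : IsErgodic P N) {lam : ℝ≥0∞} (hint : intensity P N = lam) (hlt : lam * α < 1) :
    ∀ᵐ ω ∂P, locallyFinitePart d (N ω) (fieldUnsated α R (N ω)) = 0 ∧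
      volume (fieldReached R (N ω))ᶜ = ∞ := by
  have hne := (hR.ae_conull_or hN.measurable herg).resolve_left fun h =>
    ((lintegral_fieldReached_of_conull h).symm.trans_le
      (hR.lintegral_fieldReached_le hN herg.1 hint)).not_gt hlt
  exact (hR.ae_unsated_eq_zero hN hne).and (hR.ae_volume_compl_eq_top hd hN.measurable herg hne)

/-- By ergodicity the alternative is unreached volume almost surely. Then all centers are sated, the
expected reached volume of the unit cube is `λα = 1`, and the cube is almost surely filled after
all. -/
theorem critical_conull (hR : IsRadiiField α R) (hN : IsSimplePointProcess P N)
    (herg : IsErgodic P N) {lam : ℝ≥0∞} (hint : intensity P N = lam) (heq : lam * α = 1) :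
    ∀ᵐ ω ∂P, volume (fieldReached R (N ω))ᶜ = 0 := by
  refine (hR.ae_conull_or hN.measurable herg).elim id fun hne => ?_
  have hone := hR.lintegral_fieldReached_eq hN herg.1 hint (hR.ae_unsated_eq_zero hN hne)
  rw [heq] at hone
  refine hR.ae_volume_compl_of_cell hN.measurable herg.1 ?_
  have hae : (fun ω => volume (fieldReached R (N ω) ∩ cell 0)) =ᵐ[P] fun _ => 1 := by
    refine ae_eq_of_ae_le_of_lintegral_le (Filter.Eventually.of_forall fun ω => ?_)
      (by rw [hone]; exact ENNReal.one_ne_top) aemeasurable_const (by rw [hone]; simp)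
    rw [← volume_cell_zero (d := d)]
    exact measure_mono Set.inter_subset_right
  filter_upwards [hae] with ω hω
  have hsplit := measure_inter_add_sdiff (μ := volume) (cell (0 : Fin d → ℤ))
    (hR.measurableSet_fieldReached_apply (N ω))
  rw [Set.inter_comm, hω, volume_cell_zero, Set.sdiff_eq, Set.inter_comm] at hsplit
  exact (ENNReal.add_right_inj ENNReal.one_ne_top).1 (hsplit.trans (add_zero 1).symm)

/-- The total load in a cell is at most `α` times its number of centers, and both have expectation
1. They agree almost surely, which leaves no center of the cell below `α`. -/
theorem critical_sated (hR : IsRadiiField α R) (hN : IsSimplePointProcess P N)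
    (herg : IsErgodic P N) {lam : ℝ≥0∞} (hint : intensity P N = lam) (heq : lam * α = 1) :
    ∀ᵐ ω ∂P, locallyFinitePart d (N ω) (fieldUnsated α R (N ω)) = 0 := by
  -- With `α = ∞` the product `λα` would be 0 or `∞`. Finiteness is what lets equal integrals force
  -- equal loads below.
  have hα : α ≠ ∞ := by
    rintro rfl
    by_cases h0 : lam = 0 <;> simp [h0, ENNReal.mul_top] at heq
  have hone := lintegral_fieldReached_of_conull (hR.critical_conull hN herg hint heq)
  rw [hR.lintegral_volume_fieldReached hN herg.1] at hone
  have hae : (fun ω => transport R (cell 0) Set.univ (N ω)) =ᵐ[P]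
      fun ω => α * N ω (cell 0) := by
    refine ae_eq_of_ae_le_of_lintegral_le ?_ (by rw [hone]; exact ENNReal.one_ne_top)
      (((Measure.measurable_coe (measurableSet_cell 0)).comp hN.measurable).const_mul
        α).aemeasurable ?_
    · filter_upwards [hN.ae_simple] with ω ⟨S, hfin, heq⟩
      exact hR.transport_le ⟨hfin, heq⟩
    · rw [lintegral_mul_count hN.measurable hint, hone, heq]
  refine hR.ae_unsated_of_cell hN.measurable herg.1 ?_
  filter_upwards [hae, hN.ae_simple] with ω hω ⟨S, hfin, hS⟩
  have h : CountsLocallyFinite S (N ω) := ⟨hfin, hS⟩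
  rw [transport_univ_right, h.locallyFinitePart_eq, ← setLIntegral_const] at hω
  have hfinite : ∫⁻ _ in cell 0, α ∂(N ω) ≠ ∞ := by
    rw [setLIntegral_const]
    exact ENNReal.mul_ne_top hα (h.apply_lt_top isBounded_cell_zero).ne
  have hload := ae_eq_of_ae_le_of_lintegral_le (μ := (N ω).restrict (cell 0))
    (f := fun ξ => volume (fieldTerritory R (N ω) ξ)) (g := fun _ => α)
    (ae_restrict_of_ae (h.ae_iff.2 fun ξ hξ => by
      simp only [fieldTerritory, h.locallyFinitePart_eq]
      exact (hR.stable S _ h ξ hξ).1))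
    (by rw [hω]; exact hfinite) aemeasurable_const hω.ge
  rw [h.locallyFinitePart_eq]
  have hload' := (ae_restrict_iff' (measurableSet_cell 0)).1 hload
  refine measure_mono_null (fun ξ hξ => ?_) hload'
  exact fun himp => hξ.1 (himp hξ.2)

/-- If almost surely all centers were sated, the unit cube would have expected reached volume `λα >
1`; ergodicity excludes intermediate probabilities. -/
theorem supercritical (hR : IsRadiiField α R) (hN : IsSimplePointProcess P N)
    (herg : IsErgodic P N) {lam : ℝ≥0∞} (hint : intensity P N = lam) (hlt : 1 < lam * α) :
    ∀ᵐ ω ∂P, locallyFinitePart d (N ω) (fieldUnsated α R (N ω)) ≠ 0 := by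
  have hmeas : MeasurableSet {μ | locallyFinitePart d μ (fieldUnsated α R μ) = 0} := by
    have := hR.measurable_unsated MeasurableSet.univ (measurableSet_singleton 0)
    simp only [Set.inter_univ] at this
    exact this
  refine (herg.ae_mem_or_ae_notMem hN.measurable hmeas fun v μ => ?_).resolve_left fun h => ?_
  · have := hR.unsated_translate v μ Set.univ
    simp only [Set.preimage_univ, Set.inter_univ] at this
    simp [this]
  · exact ((hR.lintegral_fieldReached_eq hN herg.1 hint h).symm.trans_le
      lintegral_fieldReached_le_one).not_gt hlt

end IsRadiiField

end Phases

/-! ### From extremal radii to arbitrary stable allocations. -/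

section Comparison

variable {d : ℕ} {S : Set (Site d)} {μ : Measure (Site d)} {α : ℝ≥0∞} {ψ : Site d → Target d}

theorem CountsLocallyFinite.isSated_of_greatestRadii (h : CountsLocallyFinite S μ) (hd : 1 ≤ d)
    (hψ : IsStableAllocation S α ψ)
    (hsat : locallyFinitePart d μ
      (fieldUnsated α (fun μ => greatestRadii α (locallyFinitePart d μ)) μ) = 0) :
    ∀ ξ ∈ S, IsSated α ψ ξ := fun ξ hξ => by
  have hst := h.isStableRadii_covetRadius hd hψ
  rw [IsRadiiField.unsated_eq_zero_iff h, h.locallyFinitePart_eq] at hsat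
  rw [IsSated, ← h.load_covetRadius hd hψ hξ]
  exact h.load_eq_of_le hst (fun η hη => h.le_greatestRadii hst hη) hξ (hsat ξ hξ)

theorem CountsLocallyFinite.ae_claimed_of_reached (h : CountsLocallyFinite S μ)
    (hψ : IsStableAllocation S α ψ) (hnull : volume (reachedSites μ (covetRadius α ψ))ᶜ = 0) :
    ∀ᵐ x, IsClaimed ψ x := by
  filter_upwards [h.ae_claimed hψ, compl_mem_ae_iff.2 hnull] with x hx hx'
  exact hx (not_not.1 hx')

theorem CountsLocallyFinite.exists_unsated_of_leastRadii (h : CountsLocallyFinite S μ)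
    (hd : 1 ≤ d) (hψ : IsStableAllocation S α ψ)
    (hunsat : locallyFinitePart d μ
      (fieldUnsated α (fun μ => leastRadii α (locallyFinitePart d μ)) μ) ≠ 0) :
    (¬ ∀ ξ ∈ S, IsSated α ψ ξ) ∧ ∀ᵐ x, IsClaimed ψ x := by
  have hst := h.isStableRadii_covetRadius hd hψ
  have hlst := h.isStableRadii_leastRadii hd α
  have hle : ∀ η ∈ S, leastRadii α μ η ≤ covetRadius α ψ η :=
    fun η hη => h.leastRadii_le hst hη
  rw [ne_eq, IsRadiiField.unsated_eq_zero_iff h, h.locallyFinitePart_eq] at hunsat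
  refine ⟨fun hsat => hunsat fun ξ hξ => h.load_eq_of_le hlst hle hξ ?_, ?_⟩
  · rw [h.load_covetRadius hd hψ hξ]
    exact hsat ξ hξ
  · push Not at hunsat
    obtain ⟨ξ, hξ, hne⟩ := hunsat
    -- An unsated center has infinite least radius, hence infinite covet radius, and so reaches
    -- every site.
    have htop : leastRadii α μ ξ = ∞ := by
      by_contra hfin
      exact hne ((hlst ξ hξ).2 hfin)
    refine h.ae_claimed_of_reached hψ ?_
    rw [h.reachedSites_eq_univ hξ (top_le_iff.1 (htop.symm.trans_le (hle ξ hξ)))]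
    simp

theorem CountsLocallyFinite.volume_unclaimedSites_eq_top (h : CountsLocallyFinite S μ)
    (hd : 1 ≤ d) (hψ : IsStableAllocation S α ψ)
    (htop : volume (fieldReached (fun μ => greatestRadii α (locallyFinitePart d μ)) μ)ᶜ = ∞) :
    volume (unclaimedSites ψ) = ∞ := by
  have hst := h.isStableRadii_covetRadius hd hψ
  rw [fieldReached, h.locallyFinitePart_eq] at htop
  rw [← top_le_iff, ← htop]
  refine measure_mono_ae ?_
  filter_upwards [h.compl_reachedSites_subset hd hψ] with x hx hxn
  exact hx fun hx' => hxn (h.reachedSites_mono (fun η hη => h.le_greatestRadii hst hη) hx')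

theorem CountsLocallyFinite.ae_claimed_of_leastRadii (h : CountsLocallyFinite S μ)
    (hd : 1 ≤ d) (hψ : IsStableAllocation S α ψ)
    (hnull : volume (fieldReached (fun μ => leastRadii α (locallyFinitePart d μ)) μ)ᶜ = 0) :
    ∀ᵐ x, IsClaimed ψ x := by
  have hst := h.isStableRadii_covetRadius hd hψ
  rw [fieldReached, h.locallyFinitePart_eq] at hnull
  refine h.ae_claimed_of_reached hψ (measure_mono_null (Set.compl_subset_compl.2 ?_) hnull)
  exact h.reachedSites_mono fun η hη => h.leastRadii_le hst hη

end Comparison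

end StableAllocation

/-! ### The phase theorem. -/

theorem theorem4 {d : ℕ} (hd : 1 ≤ d)
    {Ω : Type*} [MeasurableSpace Ω] (P : Measure Ω) [IsProbabilityMeasure P]
    (N : Ω → Measure (StableAllocation.Site d))
    (hN : StableAllocation.IsSimplePointProcess P N)
    (herg : StableAllocation.IsErgodic P N)
    (lam : ℝ≥0) (hlam : 0 < lam)
    (hint : StableAllocation.intensity P N = (lam : ℝ≥0∞))
    (α : ℝ≥0∞) :
    ((lam : ℝ≥0∞) * α < 1 →
      ∀ᵐ ω ∂P, ∀ ψ : StableAllocation.Site d → StableAllocation.Target d,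
        StableAllocation.IsStableAllocation (StableAllocation.pointSupport (N ω)) α ψ →
          (∀ ξ ∈ StableAllocation.pointSupport (N ω), StableAllocation.IsSated α ψ ξ) ∧
          volume (StableAllocation.unclaimedSites ψ) = ∞) ∧
    ((lam : ℝ≥0∞) * α = 1 →
      ∀ᵐ ω ∂P, ∀ ψ : StableAllocation.Site d → StableAllocation.Target d,
        StableAllocation.IsStableAllocation (StableAllocation.pointSupport (N ω)) α ψ →
          (∀ ξ ∈ StableAllocation.pointSupport (N ω), StableAllocation.IsSated α ψ ξ) ∧
          ∀ᵐ x ∂(volume : Measure (StableAllocation.Site d)), StableAllocation.IsClaimed ψ x) ∧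
    (1 < (lam : ℝ≥0∞) * α →
      ∀ᵐ ω ∂P, ∀ ψ : StableAllocation.Site d → StableAllocation.Target d,
        StableAllocation.IsStableAllocation (StableAllocation.pointSupport (N ω)) α ψ →
          (¬ ∀ ξ ∈ StableAllocation.pointSupport (N ω), StableAllocation.IsSated α ψ ξ) ∧
          ∀ᵐ x ∂(volume : Measure (StableAllocation.Site d)), StableAllocation.IsClaimed ψ x) := by
  have hgreat := StableAllocation.isRadiiField_greatestRadii hd α
  have hleast := StableAllocation.isRadiiField_leastRadii hd α
  refine ⟨fun hlt => ?_, fun heq => ?_, fun hlt => ?_⟩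
  · filter_upwards [hN.ae_simple, hgreat.subcritical hd hN herg hint hlt]
      with ω ⟨S, hfin, hS⟩ hω ψ hψ
    have h : StableAllocation.CountsLocallyFinite S (N ω) := ⟨hfin, hS⟩
    rw [h.pointSupport_eq] at hψ ⊢
    exact ⟨h.isSated_of_greatestRadii hd hψ hω.1, h.volume_unclaimedSites_eq_top hd hψ hω.2⟩
  · filter_upwards [hN.ae_simple, hgreat.critical_sated hN herg hint heq,
      hleast.critical_conull hN herg hint heq] with ω ⟨S, hfin, hS⟩ hsat hcon ψ hψ
    have h : StableAllocation.CountsLocallyFinite S (N ω) := ⟨hfin, hS⟩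
    rw [h.pointSupport_eq] at hψ ⊢
    exact ⟨h.isSated_of_greatestRadii hd hψ hsat, h.ae_claimed_of_leastRadii hd hψ hcon⟩
  · filter_upwards [hN.ae_simple, hleast.supercritical hN herg hint hlt]
      with ω ⟨S, hfin, hS⟩ hω ψ hψ
    have h : StableAllocation.CountsLocallyFinite S (N ω) := ⟨hfin, hS⟩
    rw [h.pointSupport_eq] at hψ ⊢
    exact h.exists_unsated_of_leastRadii hd hψ hω
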